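/- **Notation.** Let $q\in\mathbb C$, $0<|q|<1$; $(x)_n=\prod_{j=0}^{n-1}(1-xq^j)$, $(x)_\infty=\prod_{j\ge 0}(1-xq^j)$, $(x_1,\dots,x_k)_n=\prod_j (x_j)_n$ for $n\in\mathbb N\cup\{\infty\}$. For nonzero complex $a,p_0,\dots,p_6$ put $$W(a;p_0,\dots,p_6)={}_{10}\phi_9\!\left({a,\,q\sqrt a,\,-q\sqrt a,\,p_0,\dots,p_6\atop \sqrt a,\,-\sqrt a,\,\frac{aq}{p_0},\dots,\frac{aq}{p_6}};q\right)=\sum_{n\ge0}\frac{(a,q\sqrt a,-q\sqrt a,p_0,\dots,p_6)_n}{(\sqrt a,-\sqrt a,\frac{aq}{p_0},\dots,\frac{aq}{p_6},q)_n}\,q^n .$$ For $i\in\{0,\dots,6\}$ ($p_i$ is called the distinguished parameter) put $$\Phi^{(i)}(a;p_0,\dots,p_6)=W(a;p_0,\dots,p_6)+\frac{\left(aq,\frac{p_i}{a}\right)_\infty\prod_{j\ne i}\left(p_j,\frac{p_iq}{p_j}\right)_\infty}{\left(\frac{p_i^2q}{a},\frac{a}{p_i}\right)_\infty\prod_{j\neq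 i}\left(\frac{aq}{p_j},\frac{p_ip_j}{a}\right)_\infty}\;W\!\left(\frac{p_i^2}{a};p'_0,\dots,p'_6\right),$$ with $p'_i=p_i$ and $p'_j=p_ip_j/a$ for $j\ne i$. We say that $\Phi^{(i)}$ is regular at $(a;p_0,\dots,p_6)$ if no factor in a denominator of this definition vanishes, i.e. no factor in a denominator of a term of either series or of the coefficient of the second series. **Theorem.** Let $i\in\{0,\dots,6\}$. (1) Let $a,b,c,d,e,f,g,h$ be nonzero complex numbers with $bcdefgh=a^3q^2$. Write $\Phi=\Phi^{(i)}(a;b,c,d,e,f,g,h)$, $\Phi(g-,h+)=\Phi^{(i)}(a;b,c,d,e,f,g/q,hq)$ and $\Phi(h-,g+)=\Phi^{(i)}(a;b,c,d,e,f,gq,h/q)$. If $\Phi^{(i)}$ is regular at these three points, and $g\ne hq$ and $h\neq gq$, then $$\begin{aligned} &\frac{g(1-h)(1-\frac ah)(1-\frac{aq}h)(1-\frac{aq}{gb})(1-\frac{aq}{gc})(1-\frac{aq}{gd})(1-\frac{aq}{ge})(1-\frac{aq}{gf})}{1-\frac{hq}g}\,[\Phi(g-,h+)-\Phi]\\ &-\frac{h(1-g)(1-\frac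 ag)(1-\frac{aq}g)(1-\frac{aq}{hb})(1-\frac{aq}{hc})(1-\frac{aq}{hd})(1-\frac{aq}{he})(1-\frac{aq}{hf})}{1-\frac{gq}h}\,[\Phi(h-,g+)-\Phi]\\ &-\frac{aq}h\Big(1-\frac hg\Big)\Big(1-\frac{gh}{aq}\Big)(1-b)(1-c)(1-d)(1-e)(1-f)\,\Phi=0 . \end{aligned}$$ (2) Let $a,b,c,d,e,f,h$ be nonzero complex numbers and $s=\frac{a^3q^3}{bcdef}$. For $n\in\mathbb Z$ put $$A_n=\frac{(1-\frac{sq^{n-1}}h)(1-\frac{sq^{n-1}}{ah})\prod_{x\in(b,c,d,e,f)}(1-\frac{aq^{n+1}}{xh})}{(1-\frac{sq^{2n}}{h^2})(1-\frac{sq^{2n-1}}{h^2})(1-\frac{aq^{n+1}}h)},\qquad B_n=\frac{q(1-\frac{q^n}h)(1-\frac{aq^n}h)\prod_{x\in(b,c,d,e,f)}(1-\frac{xsq^{n-2}}{ah})}{(1-\frac{sq^{2n-1}}{h^2})(1-\frac{sq^{2n-2}}{h^2})(1-\frac{sq^{n-2}}{ah})},$$ $$a_n=A_n+B_n+\frac{sq^{2n-1}}{ah^2}\,\frac{(1-\frac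 s{aq^2})(1-b)(1-c)(1-d)(1-e)(1-f)}{(1-\frac ahq^{n+1})(1-\frac s{ah}q^{n-2})},\qquad b_n=A_{n-1}B_n,$$ $$X_n=\frac{\left(\frac{sq^{2n-1}}{h^2},\frac{aq^{n+1}}h\right)_\infty}{\left(\frac{sq^{n-1}}h,\frac{sq^{n-1}}{ah},\frac{aq^{n+1}}{bh},\frac{aq^{n+1}}{ch},\frac{aq^{n+1}}{dh},\frac{aq^{n+1}}{eh},\frac{aq^{n+1}}{fh}\right)_\infty}\;\Phi^{(i)}\!\left(a;b,c,d,e,f,\tfrac{sq^{n-1}}h,hq^{-n}\right).$$ Then, for every $n\in\mathbb Z$, $$X_{n+1}-a_nX_n+b_nX_{n-1}=0,$$ provided that for $m=n-1,n,n+1$ the function $\Phi^{(i)}$ is regular at $(a;b,c,d,e,f,\frac{sq^{m-1}}h,hq^{-m})$ and the denominator in $X_m$ does not vanish, and that $sq^k\ne h^2$ for $k=2n-3,\dots,2n$. -/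

import Mathlib

open scoped BigOperators

noncomputable section

namespace QHyp

/-- The `q`-shifted factorial `(x)_n = ∏_{j=1}^n (1 - x q^{j-1})`. -/
def poch (q x : ℂ) (n : ℕ) : ℂ := ∏ j ∈ Finset.range n, (1 - x * q ^ j)

/-- The infinite `q`-shifted factorial `(x)_∞ = ∏_{j=1}^∞ (1 - x q^{j-1})` (used for `|q| < 1`,
where the product converges). -/
def pochInf (q x : ℂ) : ℂ := ∏' j : ℕ, (1 - x * q ^ j)

/-- `(x₁, …, x_k)_n = (x₁)_n ⋯ (x_k)_n`. -/
def pochs (q : ℂ) (L : List ℂ) (n : ℕ) : ℂ := (L.map fun x => poch q x n).prod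

/-- `(x₁, …, x_k)_∞ = (x₁)_∞ ⋯ (x_k)_∞`. -/
def pochsInf (q : ℂ) (L : List ℂ) : ℂ := (L.map fun x => pochInf q x).prod

/-- The basic hypergeometric series `_rφ_s(A; B; z)` to the base `q`, with `r` and `s` the lengths
of the lists `A` and `B`. -/
def basicHyp (q : ℂ) (A B : List ℂ) (z : ℂ) : ℂ :=
  ∑' n : ℕ, pochs q A n / (pochs q B n * poch q q n)
    * ((-1) ^ n * q ^ (n.choose 2)) ^ (1 + (B.length : ℤ) - (A.length : ℤ)) * z ^ n

/-- The numerator parameters `a, q√a, -q√a, p₀, …, p₆` of the very-well-poised series. -/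
def upperW (q a : ℂ) (p : Fin 7 → ℂ) : List ℂ :=
  a :: q * a.sqrt :: -(q * a.sqrt) :: List.ofFn p

/-- The denominator parameters `√a, -√a, aq/p₀, …, aq/p₆` of the very-well-poised series. -/
def lowerW (q a : ℂ) (p : Fin 7 → ℂ) : List ℂ :=
  a.sqrt :: -a.sqrt :: List.ofFn fun j => a * q / p j

/-- The very-well-poised series `₁₀W₉(a; p₀, …, p₆; q)`; it is balanced when
`p₀ ⋯ p₆ = a³q²`. -/
def W (q a : ℂ) (p : Fin 7 → ℂ) : ℂ := basicHyp q (upperW q a p) (lowerW q a p) q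

/-- The parameters of the complementary series: `p_i` stays, and `p_j` becomes `p_i p_j / a`
for `j ≠ i`. Its first parameter is `p_i² / a`. -/
def compl (a : ℂ) (p : Fin 7 → ℂ) (i : Fin 7) : Fin 7 → ℂ :=
  fun j => if j = i then p i else p i * p j / a

/-- Numerator of the coefficient of the complementary series. -/
def coeffNum (q a : ℂ) (p : Fin 7 → ℂ) (i : Fin 7) : ℂ :=
  pochsInf q [a * q, p i / a] *
    ∏ j ∈ Finset.univ.erase i, pochsInf q [p j, p i * q / p j]

/-- Denominator of the coefficient of the complementary series. -/
def coeffDen (q a : ℂ) (p : Fin 7 → ℂ) (i : Fin 7) : ℂ :=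
  pochsInf q [p i ^ 2 * q / a, a / p i] *
    ∏ j ∈ Finset.univ.erase i, pochsInf q [a * q / p j, p i * p j / a]

/-- The complementary pair `Φ = φ + φ'` with parameters `a; p₀, …, p₆` whose distinguished
parameter is `p_i`. -/
def Phi (q : ℂ) (i : Fin 7) (a : ℂ) (p : Fin 7 → ℂ) : ℂ :=
  W q a p + coeffNum q a p i / coeffDen q a p i * W q (p i ^ 2 / a) (compl a p i)

/-- The definition of `Φ` with distinguished parameter `p_i` has no singularity: no factor in a
denominator, of a term of one of the two series or of the coefficient, vanishes. -/
def Regular (q : ℂ) (i : Fin 7) (a : ℂ) (p : Fin 7 → ℂ) : Prop :=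
  (∀ n : ℕ, pochs q (lowerW q a p) n ≠ 0) ∧
  (∀ n : ℕ, pochs q (lowerW q (p i ^ 2 / a) (compl a p i)) n ≠ 0) ∧
  coeffDen q a p i ≠ 0

/-! The recurrence in `n` that results from `g = s q^{n-1} / h`, `h → h q^{-n}`. -/

/-- `s = a³q³ / (bcdef)`. -/
def recS (q a b c d e f : ℂ) : ℂ := a ^ 3 * q ^ 3 / (b * c * d * e * f)

/-- The parameters `b, c, d, e, f, s q^{n-1} / h, h q^{-n}`. -/
def recParams (q a b c d e f h : ℂ) (n : ℤ) : Fin 7 → ℂ :=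
  ![b, c, d, e, f, recS q a b c d e f * q ^ (n - 1) / h, h * q ^ (-n)]

/-- The quantity `A_n`. -/
def recA (q a b c d e f h : ℂ) (n : ℤ) : ℂ :=
  let s := recS q a b c d e f
  (1 - s * q ^ (n - 1) / h) * (1 - s * q ^ (n - 1) / (a * h))
    * (1 - a * q ^ (n + 1) / (b * h)) * (1 - a * q ^ (n + 1) / (c * h))
    * (1 - a * q ^ (n + 1) / (d * h)) * (1 - a * q ^ (n + 1) / (e * h))
    * (1 - a * q ^ (n + 1) / (f * h))
  / ((1 - s * q ^ (2 * n) / h ^ 2) * (1 - s * q ^ (2 * n - 1) / h ^ 2)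
    * (1 - a * q ^ (n + 1) / h))

/-- The quantity `B_n`. -/
def recB (q a b c d e f h : ℂ) (n : ℤ) : ℂ :=
  let s := recS q a b c d e f
  q * (1 - q ^ n / h) * (1 - a * q ^ n / h)
    * (1 - b * s * q ^ (n - 2) / (a * h)) * (1 - c * s * q ^ (n - 2) / (a * h))
    * (1 - d * s * q ^ (n - 2) / (a * h)) * (1 - e * s * q ^ (n - 2) / (a * h))
    * (1 - f * s * q ^ (n - 2) / (a * h))
  / ((1 - s * q ^ (2 * n - 1) / h ^ 2) * (1 - s * q ^ (2 * n - 2) / h ^ 2)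
    * (1 - s * q ^ (n - 2) / (a * h)))

/-- The coefficient `a_n` of the recurrence. -/
def recCoeffA (q a b c d e f h : ℂ) (n : ℤ) : ℂ :=
  let s := recS q a b c d e f
  recA q a b c d e f h n + recB q a b c d e f h n
    + s * q ^ (2 * n - 1) / (a * h ^ 2)
      * ((1 - s / (a * q ^ 2)) * (1 - b) * (1 - c) * (1 - d) * (1 - e) * (1 - f)
        / ((1 - a / h * q ^ (n + 1)) * (1 - s / (a * h) * q ^ (n - 2))))

/-- The coefficient `b_n` of the recurrence. -/
def recCoeffB (q a b c d e f h : ℂ) (n : ℤ) : ℂ :=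
  recA q a b c d e f h (n - 1) * recB q a b c d e f h n

/-- Numerator of the normalizing factor of `X_n`. -/
def normNum (q a b c d e f h : ℂ) (n : ℤ) : ℂ :=
  let s := recS q a b c d e f
  pochsInf q [s * q ^ (2 * n - 1) / h ^ 2, a * q ^ (n + 1) / h]

/-- Denominator of the normalizing factor of `X_n`. -/
def normDen (q a b c d e f h : ℂ) (n : ℤ) : ℂ :=
  let s := recS q a b c d e f
  pochsInf q [s * q ^ (n - 1) / h, s * q ^ (n - 1) / (a * h), a * q ^ (n + 1) / (b * h),
    a * q ^ (n + 1) / (c * h), a * q ^ (n + 1) / (d * h), a * q ^ (n + 1) / (e * h),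
    a * q ^ (n + 1) / (f * h)]

/-- The renormalized function `X_n`, for the distinguished parameter with index `i`. -/
def X (q : ℂ) (i : Fin 7) (a b c d e f h : ℂ) (n : ℤ) : ℂ :=
  normNum q a b c d e f h n / normDen q a b c d e f h n
    * Phi q i a (recParams q a b c d e f h n)

end QHyp

end

namespace QHyp

open Filter Topology

/-! Both series of a complementary pair sample one function of a continuous variable, `bterm`
$(x)=x(1-ax^2)\,(qx)_\infty\prod_j(aqx/p_j)_\infty/\big((ax)_\infty\prod_j(p_jx)_\infty\big)$. Along
$x=q^n$ it runs through the terms of the first series, along $x=(p_i/a)q^n$ through those of the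
second, and the coefficient in $\Phi$ is exactly $-$`bterm`$(p_i/a)/$`bterm`$(1)$. Hence
`bterm`$(1)\,\Phi$ is a difference of two lattice sums (`bterm_one_mul_Phi`).

The contiguous relation holds for the summands up to a $q$-difference: a combination of the three
`bterm`s with coefficients free of $x$ equals `bcert`$(xq)-$`bcert`$(x)$ (`bterm_contiguous`), which
after division by a common factor is a polynomial identity in $x$ (`contiguous_polynomial`). Summed
over either lattice the right side telescopes. The boundary term at the start vanishes, and the
limit $x\to0$ is `certConst`, the same for both lattices (`tsum_bterm_contiguous`). A single series
thus satisfies an inhomogeneous relation, and the inhomogeneity cancels in the pair.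

This argument divides by many infinite products, so it is carried out at parameters avoiding all
powers of $q$ (`Phi_contiguous_of_generic`). Regular points are limits of such parameters along a
curve that keeps the series balanced, and $\Phi$ is continuous along it (`tendsto_Phi`). The
recurrence in $n$ is the same relation with $g=sq^{n-1}/h$ and $h$ replaced by $hq^{-n}$; the
normalization of $X_n$ absorbs one coefficient (`norm_mul_recA`, `recCoeffs_eq`). -/

/-! ### Shifted factorials: splitting, zeros, bounds, continuity -/

lemma summable_norm_mul_pow {q : ℂ} (hq1 : ‖q‖ < 1) (x : ℂ) :
    Summable fun j : ℕ => ‖-(x * q ^ j)‖ := by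
  simp only [norm_neg, norm_mul, norm_pow]
  exact (summable_geometric_of_lt_one (norm_nonneg q) hq1).mul_left _

lemma multipliable_pochInf {q : ℂ} (hq1 : ‖q‖ < 1) (x : ℂ) :
    Multipliable fun j : ℕ => 1 - x * q ^ j := by
  simpa only [sub_eq_add_neg] using multipliable_one_add_of_summable (summable_norm_mul_pow hq1 x)

lemma poch_mul_pochInf {q : ℂ} (hq1 : ‖q‖ < 1) (x : ℂ) (n : ℕ) :
    poch q x n * pochInf q (x * q ^ n) = pochInf q x := by
  have h : Multipliable fun j : ℕ => 1 - x * q ^ (j + n) := by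
    simpa only [pow_add, mul_assoc, mul_comm, mul_left_comm] using
      multipliable_pochInf hq1 (x * q ^ n)
  have := h.prod_mul_tprod_nat_mul' (f := fun j : ℕ => 1 - x * q ^ j)
  unfold poch pochInf
  rw [← this]
  congr 1
  refine tprod_congr fun j => ?_
  ring

lemma pochInf_eq {q : ℂ} (hq1 : ‖q‖ < 1) (x : ℂ) :
    pochInf q x = (1 - x) * pochInf q (x * q) := by
  simpa [poch] using (poch_mul_pochInf hq1 x 1).symm

lemma pochInf_ne_zero {q : ℂ} (hq1 : ‖q‖ < 1) {x : ℂ} (hx : ∀ n : ℕ, x * q ^ n ≠ 1) :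
    pochInf q x ≠ 0 := by
  have := tprod_one_add_ne_zero_of_summable (f := fun j : ℕ => -(x * q ^ j))
    (fun n => by rw [← sub_eq_add_neg]; exact sub_ne_zero.2 (hx n).symm)
    (summable_norm_mul_pow hq1 x)
  simp only [← sub_eq_add_neg] at this
  exact this

lemma pochInf_eq_zero {q : ℂ} (hq1 : ‖q‖ < 1) {x : ℂ} (n : ℕ) (hx : x * q ^ n = 1) :
    pochInf q x = 0 := by
  rw [← poch_mul_pochInf hq1 x (n + 1), poch, Finset.prod_range_succ, hx]
  simp

lemma mul_pow_ne_one_of_pochInf_ne_zero {q : ℂ} (hq1 : ‖q‖ < 1) {x : ℂ} (hx : pochInf q x ≠ 0)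
    (n : ℕ) : x * q ^ n ≠ 1 := fun h => hx (pochInf_eq_zero hq1 n h)

lemma poch_ne_zero {q x : ℂ} (hx : ∀ n : ℕ, x * q ^ n ≠ 1) (n : ℕ) : poch q x n ≠ 0 :=
  Finset.prod_ne_zero_iff.2 fun j _ => sub_ne_zero.2 (hx j).symm

lemma mul_pow_ne_one_of_poch_ne_zero {q x : ℂ} (hx : ∀ n : ℕ, poch q x n ≠ 0) (n : ℕ) :
    x * q ^ n ≠ 1 := fun h =>
  (Finset.prod_ne_zero_iff.1 (hx (n + 1)) n (by simp)) (by rw [h, sub_self])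

lemma pow_succ_ne_one {q : ℂ} (hq1 : ‖q‖ < 1) (n : ℕ) : q * q ^ n ≠ 1 := by
  intro h
  have := congrArg norm h
  rw [← pow_succ', norm_pow, norm_one] at this
  exact absurd this (pow_lt_one₀ (norm_nonneg q) hq1 (by omega)).ne

/-- The bound does not depend on `n`; it supplies the majorants for dominated convergence. -/
lemma norm_poch_le {q : ℂ} (hq1 : ‖q‖ < 1) (x : ℂ) (n : ℕ) :
    ‖poch q x n‖ ≤ Real.exp (‖x‖ / (1 - ‖q‖)) := by
  have hs := (summable_geometric_of_lt_one (norm_nonneg q) hq1).mul_left ‖x‖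
  calc ‖poch q x n‖ ≤ ∏ j ∈ Finset.range n, (1 + ‖x‖ * ‖q‖ ^ j) := by
        rw [poch, norm_prod]
        refine Finset.prod_le_prod (fun _ _ => norm_nonneg _) fun j _ => ?_
        refine (norm_sub_le _ _).trans ?_
        simp
    _ ≤ Real.exp (∑ j ∈ Finset.range n, ‖x‖ * ‖q‖ ^ j) :=
        Real.prod_one_add_le_exp_sum _ fun j => by positivity
    _ ≤ Real.exp (‖x‖ / (1 - ‖q‖)) := by
        refine Real.exp_le_exp.2 ((hs.sum_le_tsum _ fun _ _ => by positivity).trans_eq ?_)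
        rw [tsum_mul_left, tsum_geometric_of_lt_one (norm_nonneg q) hq1, div_eq_mul_inv]

lemma tendsto_poch {q : ℂ} (hq1 : ‖q‖ < 1) (x : ℂ) :
    Tendsto (poch q x) atTop (𝓝 (pochInf q x)) :=
  (multipliable_pochInf hq1 x).hasProd.tendsto_prod_nat

lemma norm_pochInf_le {q : ℂ} (hq1 : ‖q‖ < 1) (x : ℂ) :
    ‖pochInf q x‖ ≤ Real.exp (‖x‖ / (1 - ‖q‖)) :=
  le_of_tendsto (tendsto_poch hq1 x).norm (Eventually.of_forall fun n => norm_poch_le hq1 x n)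

lemma continuous_poch (q : ℂ) (n : ℕ) : Continuous fun x => poch q x n := by
  unfold poch
  fun_prop

lemma continuous_pochInf {q : ℂ} (hq1 : ‖q‖ < 1) : Continuous (pochInf q) := by
  rw [continuous_iff_continuousAt]
  intro x
  have := tendsto_tprod_one_add_of_dominated_convergence (𝓕 := 𝓝 x)
    (f := fun (y : ℂ) (j : ℕ) => -(y * q ^ j)) (g := fun j : ℕ => -(x * q ^ j))
    (bound := fun j => (‖x‖ + 1) * ‖q‖ ^ j)
    ((summable_geometric_of_lt_one (norm_nonneg q) hq1).mul_left _)
    (fun j => by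
      have : Continuous fun y : ℂ => -(y * q ^ j) := by fun_prop
      exact this.tendsto x)
    (by
      filter_upwards [continuous_norm.continuousAt.eventually_lt
        (continuousAt_const (y := ‖x‖ + 1)) (lt_add_one _)] with y hy j
      rw [norm_neg, norm_mul, norm_pow]
      gcongr)
  simp only [← sub_eq_add_neg] at this
  exact this

lemma pochInf_zero (q : ℂ) : pochInf q 0 = 1 := by simp [pochInf]

/-! ### The very-well-poised series without square roots -/

/-- The terms of the very-well-poised series, with the square roots of `a` eliminated. -/
noncomputable def wterm (q a : ℂ) (p : Fin 7 → ℂ) (n : ℕ) : ℂ :=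
  q ^ n * (1 - a * q ^ (2 * n)) * (poch q a n * ∏ j, poch q (p j) n)
    / ((1 - a) * (poch q q n * ∏ j, poch q (a * q / p j) n))

lemma poch_mul_shift (q x : ℂ) (n : ℕ) :
    (1 - x) * poch q (x * q) n = poch q x n * (1 - x * q ^ n) := by
  have h1 : poch q x (n + 1) = poch q x n * (1 - x * q ^ n) := Finset.prod_range_succ _ _
  have h2 : poch q x (n + 1) = (1 - x) * poch q (x * q) n := by
    unfold poch
    rw [Finset.prod_range_succ', mul_comm]
    simp only [pow_zero, mul_one]
    congr 1
    refine Finset.prod_congr rfl fun j _ => ?_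
    ring
  rw [← h1, h2]

lemma pochs_ofFn {m : ℕ} (q : ℂ) (p : Fin m → ℂ) (n : ℕ) :
    pochs q (List.ofFn p) n = ∏ j, poch q (p j) n := by
  simp [pochs, List.map_ofFn, List.prod_ofFn]

lemma pochs_lowerW (q a : ℂ) (p : Fin 7 → ℂ) (n : ℕ) :
    pochs q (lowerW q a p) n
      = poch q a.sqrt n * (poch q (-a.sqrt) n * ∏ j, poch q (a * q / p j) n) := by
  rw [← pochs_ofFn]
  simp [lowerW, pochs]

lemma pochs_upperW (q a : ℂ) (p : Fin 7 → ℂ) (n : ℕ) :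
    pochs q (upperW q a p) n
      = poch q a n * (poch q (q * a.sqrt) n * (poch q (-(q * a.sqrt)) n * ∏ j, poch q (p j) n)) := by
  rw [← pochs_ofFn]
  simp [upperW, pochs]

lemma sqrt_mul_self (a : ℂ) : a.sqrt * a.sqrt = a := by
  rw [← sq]
  exact_mod_cast Complex.cpow_nat_inv_pow a two_ne_zero

lemma sqrt_mul_pow_ne {q a : ℂ} (ha : ∀ k : ℕ, a * q ^ (2 * k) ≠ 1) (k : ℕ) :
    a.sqrt * q ^ k ≠ 1 ∧ -a.sqrt * q ^ k ≠ 1 := by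
  have h := ha k
  rw [← sqrt_mul_self a] at h
  constructor
  · intro h'
    apply h
    calc a.sqrt * a.sqrt * q ^ (2 * k) = (a.sqrt * q ^ k) * (a.sqrt * q ^ k) := by ring
      _ = 1 := by rw [h', one_mul]
  · intro h'
    apply h
    calc a.sqrt * a.sqrt * q ^ (2 * k) = (-a.sqrt * q ^ k) * (-a.sqrt * q ^ k) := by ring
      _ = 1 := by rw [h', one_mul]

/-- The four factorials with $\sqrt a$ collapse to $(1-aq^{2n})/(1-a)$. This makes the terms
rational in $a$, so the branch cut of the square root plays no role in the later limits. -/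
lemma W_eq_tsum {q a : ℂ} (ha : ∀ k : ℕ, a * q ^ (2 * k) ≠ 1) (p : Fin 7 → ℂ) :
    W q a p = ∑' n, wterm q a p n := by
  unfold W basicHyp
  refine tsum_congr fun n => ?_
  rw [pochs_lowerW, pochs_upperW, wterm]
  have hl : (1 + ((lowerW q a p).length : ℤ) - ((upperW q a p).length : ℤ)) = 0 := by
    simp [lowerW, upperW]
  rw [hl, zpow_zero, mul_one]
  have hr := sqrt_mul_self a
  have h1 := poch_ne_zero (fun k => (sqrt_mul_pow_ne ha k).1) n
  have h2 := poch_ne_zero (fun k => (sqrt_mul_pow_ne ha k).2) n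
  have e1 := poch_mul_shift q a.sqrt n
  have e2 := poch_mul_shift q (-a.sqrt) n
  have h0 : (1 - a) ≠ 0 := sub_ne_zero.2 (by simpa using (ha 0).symm)
  have e3 : poch q (q * a.sqrt) n * poch q (-(q * a.sqrt)) n * (1 - a)
      = poch q a.sqrt n * poch q (-a.sqrt) n * (1 - a * q ^ (2 * n)) := by
    rw [show q * a.sqrt = a.sqrt * q by ring, show -(a.sqrt * q) = -a.sqrt * q by ring]
    have e4 : (1 - a) = (1 - a.sqrt) * (1 - -a.sqrt) := by linear_combination hr
    have e5 : (1 - a * q ^ (2 * n)) = (1 - a.sqrt * q ^ n) * (1 - -a.sqrt * q ^ n) := by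
      linear_combination (q ^ n) ^ 2 * hr
    rw [e4, e5]
    linear_combination (1 - -a.sqrt) * poch q (-a.sqrt * q) n * e1
      + poch q a.sqrt n * (1 - a.sqrt * q ^ n) * e2
  generalize ∏ j, poch q (p j) n = A at *
  generalize ∏ j, poch q (a * q / p j) n = B at *
  rw [show poch q a n * (poch q (q * a.sqrt) n * (poch q (-(q * a.sqrt)) n * A))
      = (poch q (q * a.sqrt) n * poch q (-(q * a.sqrt)) n) * (poch q a n * A) by ring,
    eq_div_of_mul_eq h0 e3]
  generalize poch q q n = D
  -- Nothing is assumed about `p`: if a denominator vanishes, both sides are zero because division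
  -- by zero gives zero.
  rcases eq_or_ne B 0 with hB | hB
  · simp [hB]
  rcases eq_or_ne D 0 with hD | hD
  · simp [hD]
  field_simp

/-! ### The complementary pair as a difference of two lattice sums -/

/-- The summand of the bilateral form of the series: the two series of a complementary pair are,
up to a common factor, the sums of `bterm` over `q ^ n` and over `(p i / a) * q ^ n`. -/
noncomputable def bterm (q a : ℂ) (p : Fin 7 → ℂ) (x : ℂ) : ℂ :=
  x * (1 - a * x ^ 2) * (pochInf q (q * x) * ∏ j, pochInf q (a * q * x / p j))
    / (pochInf q (a * x) * ∏ j, pochInf q (p j * x))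

/-- By $(y)_\infty=(y)_n(yq^n)_\infty$ in each factor, the ratio is a term of a very-well-poised
shape with $ax^2$ in place of $a$. It is used at $x=1$ and $x=p_i/a$. -/
lemma bterm_mul_pow {q : ℂ} (hq1 : ‖q‖ < 1) (a : ℂ) (p : Fin 7 → ℂ) (x : ℂ)
    (h1 : pochInf q (q * x) ≠ 0) (h2 : ∀ j, pochInf q (a * q * x / p j) ≠ 0)
    (h4 : 1 - a * x ^ 2 ≠ 0) (h5 : pochInf q (a * x) ≠ 0) (h6 : ∀ j, pochInf q (p j * x) ≠ 0)
    (n : ℕ) :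
    bterm q a p (x * q ^ n) = bterm q a p x *
      (q ^ n * (1 - a * x ^ 2 * q ^ (2 * n)) * (poch q (a * x) n * ∏ j, poch q (p j * x) n)
        / ((1 - a * x ^ 2) * (poch q (q * x) n * ∏ j, poch q (a * q * x / p j) n))) := by
  have key : ∀ y, pochInf q y ≠ 0 →
      pochInf q (y * q ^ n) ≠ 0 ∧ poch q y n ≠ 0 := fun y hy => by
    rw [← poch_mul_pochInf hq1 y n] at hy
    exact ⟨right_ne_zero_of_mul hy, left_ne_zero_of_mul hy⟩
  unfold bterm
  have e1 : ∀ j, pochInf q (a * q * x / p j)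
      = poch q (a * q * x / p j) n * pochInf q (a * q * (x * q ^ n) / p j) := fun j => by
    rw [← poch_mul_pochInf hq1 (a * q * x / p j) n]; congr 2; ring
  have e2 : ∀ j, pochInf q (p j * x) = poch q (p j * x) n * pochInf q (p j * (x * q ^ n)) :=
    fun j => by
    rw [← poch_mul_pochInf hq1 (p j * x) n]; congr 2; ring
  have e3 : pochInf q (q * x) = poch q (q * x) n * pochInf q (q * (x * q ^ n)) := by
    rw [← poch_mul_pochInf hq1 (q * x) n]; congr 2; ring
  have e4 : pochInf q (a * x) = poch q (a * x) n * pochInf q (a * (x * q ^ n)) := by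
    rw [← poch_mul_pochInf hq1 (a * x) n]; congr 2; ring
  have n1 : ∏ j, poch q (a * q * x / p j) n ≠ 0 :=
    Finset.prod_ne_zero_iff.2 fun j _ => (key _ (h2 j)).2
  have n2 : ∏ j, pochInf q (p j * (x * q ^ n)) ≠ 0 :=
    Finset.prod_ne_zero_iff.2 fun j _ => by
      have := (key _ (h6 j)).1; rwa [mul_assoc] at this
  have n3 : ∏ j, poch q (p j * x) n ≠ 0 :=
    Finset.prod_ne_zero_iff.2 fun j _ => (key _ (h6 j)).2
  have n4 := (key _ h1).2
  have n5 := (key _ h5).2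
  have n6 : pochInf q (a * (x * q ^ n)) ≠ 0 := by
    have := (key _ h5).1; rwa [mul_assoc] at this
  simp only [e1, e2, e3, e4, Finset.prod_mul_distrib]
  generalize ∏ j, poch q (a * q * x / p j) n = A1 at *
  generalize ∏ j, pochInf q (p j * (x * q ^ n)) = A2 at *
  generalize ∏ j, poch q (p j * x) n = A3 at *
  generalize ∏ j, pochInf q (a * q * (x * q ^ n) / p j) = A4 at *
  generalize pochInf q (a * (x * q ^ n)) = A5 at *
  generalize poch q (q * x) n = A6 at *
  generalize poch q (a * x) n = A7 at *
  rw [show a * (x * q ^ n) ^ 2 = a * x ^ 2 * q ^ (2 * n) by ring]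
  generalize 1 - a * x ^ 2 * q ^ (2 * n) = A8
  generalize 1 - a * x ^ 2 = A9 at *
  field_simp

/-- Parameters at which no factor in the definition of the complementary pair degenerates. -/
structure Generic (q : ℂ) (i : Fin 7) (a : ℂ) (p : Fin 7 → ℂ) : Prop where
  a_ne_zero : a ≠ 0
  p_ne_zero : ∀ j, p j ≠ 0
  a_ne : ∀ k : ℤ, a ≠ q ^ k
  p_ne : ∀ j, ∀ k : ℤ, p j ≠ q ^ k
  pp_ne : ∀ j, ∀ k : ℤ, p i * p j / a ≠ q ^ k
  pa_ne : ∀ j, ∀ k : ℤ, p j / a ≠ q ^ k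
  quot_ne : ∀ j, j ≠ i → ∀ k : ℤ, p i / p j ≠ q ^ k

lemma pochInf_mul_zpow_ne_zero {q : ℂ} (hq0 : q ≠ 0) (hq1 : ‖q‖ < 1) {x : ℂ}
    (hx : ∀ k : ℤ, x ≠ q ^ k) (m : ℤ) : pochInf q (x * q ^ m) ≠ 0 := by
  refine pochInf_ne_zero hq1 fun n h => hx (-(m + n)) ?_
  rw [zpow_neg, ← mul_eq_one_iff_eq_inv₀ (zpow_ne_zero _ hq0), zpow_add₀ hq0, zpow_natCast,
    ← mul_assoc, h]

lemma ne_zpow_inv {q x y : ℂ} (hx : ∀ k : ℤ, x / y ≠ q ^ k) (k : ℤ) : y / x ≠ q ^ k := by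
  intro h
  apply hx (-k)
  rw [zpow_neg, ← h, inv_div]

lemma mul_zpow_ne_one {q : ℂ} (hq0 : q ≠ 0) {x : ℂ}
    (hx : ∀ k : ℤ, x ≠ q ^ k) (m : ℤ) : x * q ^ m ≠ 1 := by
  intro h
  apply hx (-m)
  rw [zpow_neg, ← mul_eq_one_iff_eq_inv₀ (zpow_ne_zero _ hq0), h]

/-- Each series is its lattice sum divided by the first term, and the coefficient of the second
series converts one first term into the other, up to sign. -/
theorem bterm_one_mul_Phi {q : ℂ} (hq0 : q ≠ 0) (hq1 : ‖q‖ < 1) {i : Fin 7} {a : ℂ}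
    {p : Fin 7 → ℂ} (hg : Generic q i a p) :
    bterm q a p 1 * Phi q i a p
      = ∑' n : ℕ, bterm q a p (q ^ n) - ∑' n : ℕ, bterm q a p (p i / a * q ^ n) := by
  have ha := hg.a_ne_zero
  have hp := hg.p_ne_zero
  have nz := fun {x : ℂ} (hx : ∀ k : ℤ, x ≠ q ^ k) => pochInf_mul_zpow_ne_zero hq0 hq1 hx
  have nz0 := fun {x : ℂ} (hx : ∀ k : ℤ, x ≠ q ^ k) => by simpa using nz hx 0
  have nz1 := fun {x : ℂ} (hx : ∀ k : ℤ, x ≠ q ^ k) => by simpa using nz hx 1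
  have hqq : pochInf q q ≠ 0 := pochInf_ne_zero hq1 (pow_succ_ne_one hq1)
  have hap : ∀ j, ∀ k : ℤ, a / p j ≠ q ^ k := fun j => ne_zpow_inv (hg.pa_ne j)
  have hsq : ∀ k : ℤ, p i ^ 2 / a ≠ q ^ k := by simpa only [sq] using hg.pp_ne i
  have ev : ∀ {x : ℂ}, (∀ k : ℤ, x ≠ q ^ k) → ∀ k : ℕ, x * q ^ (2 * k) ≠ 1 := fun hx k => by
    exact_mod_cast mul_zpow_ne_one hq0 hx ((2 * k : ℕ) : ℤ)
  have hau : a * (p i / a) = p i := by field_simp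
  have hau2 : a * (p i / a) ^ 2 = p i ^ 2 / a := by field_simp
  have hpu : ∀ j, p j * (p i / a) = p i * p j / a := fun j => by ring
  have haqu : ∀ j, a * q * (p i / a) / p j = p i * q / p j := fun j => by field_simp
  have hqu : q * (p i / a) = p i / a * q := by ring
  have hprod : ∀ f : Fin 7 → ℂ, ∏ j, f j = f i * ∏ j ∈ Finset.univ.erase i, f j := fun f =>
    (Finset.mul_prod_erase _ _ (Finset.mem_univ i)).symm
  have apq : ∀ j, pochInf q (a * q / p j) ≠ 0 := fun j => by
    have := nz1 (hap j); rwa [div_mul_eq_mul_div] at this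
  have piq : ∀ j, pochInf q (p i * q / p j) ≠ 0 := fun j => by
    rcases eq_or_ne j i with rfl | hj
    · rwa [mul_div_right_comm, div_self (hp j), one_mul]
    · have := nz1 (hg.quot_ne j hj); rwa [div_mul_eq_mul_div] at this
  have h1a : (1 : ℂ) - a ≠ 0 := sub_ne_zero.2 (by simpa using (hg.a_ne 0).symm)
  have h1u : (1 : ℂ) - p i ^ 2 / a ≠ 0 := sub_ne_zero.2 (by simpa using (hsq 0).symm)
  -- the first series
  have s1 : bterm q a p 1 * W q a p = ∑' n : ℕ, bterm q a p (q ^ n) := by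
    rw [W_eq_tsum (ev hg.a_ne), ← tsum_mul_left]
    refine tsum_congr fun n => ?_
    have := bterm_mul_pow hq1 a p 1 (by simpa using hqq) (fun j => by simpa using apq j)
      (by simpa using h1a) (by simpa using nz0 hg.a_ne)
      (fun j => by simpa using nz0 (hg.p_ne j)) n
    simp only [one_mul, mul_one, one_pow] at this
    rw [this, wterm]
  -- the second series
  have s2 : bterm q a p (p i / a) * W q (p i ^ 2 / a) (compl a p i)
      = ∑' n : ℕ, bterm q a p (p i / a * q ^ n) := by
    rw [W_eq_tsum (ev hsq), ← tsum_mul_left]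
    refine tsum_congr fun n => ?_
    rw [bterm_mul_pow hq1 a p (p i / a) (by rw [hqu]; exact nz1 (hg.pa_ne i))
      (fun j => by rw [haqu]; exact piq j)
      (by rwa [hau2]) (by rw [hau]; exact nz0 (hg.p_ne i))
      (fun j => by rw [hpu]; exact nz0 (hg.pp_ne j)) n, wterm]
    -- At $x=p_i/a$ roles are exchanged: $p_ix=p_i^2/a$ becomes the leading parameter, $ax=p_i$ an
    -- ordinary one, and $aqx/p_i=q$ supplies $(q)_n$.
    simp only [hau, hau2, hpu, haqu, hqu, hprod]
    have c1 : compl a p i i = p i := by simp [compl]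
    have c2 : ∏ j ∈ Finset.univ.erase i, poch q (compl a p i j) n
        = ∏ j ∈ Finset.univ.erase i, poch q (p i * p j / a) n :=
      Finset.prod_congr rfl fun j hj => by simp [compl, Finset.ne_of_mem_erase hj]
    have c3 : ∏ j ∈ Finset.univ.erase i, poch q (p i ^ 2 / a * q / compl a p i j) n
        = ∏ j ∈ Finset.univ.erase i, poch q (p i * q / p j) n :=
      Finset.prod_congr rfl fun j hj => by
        have := hp i
        have := hp j
        simp only [compl, Finset.ne_of_mem_erase hj, if_false]
        congr 1
        field_simp
    have c4 : p i ^ 2 / a * q / p i = p i / a * q := by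
      have := hp i
      field_simp
    have c5 : p i * q / p i = q := by
      have := hp i
      field_simp
    rw [c1, c2, c3, c4, c5, show p i * p i / a = p i ^ 2 / a by ring]
    ring
  -- the coefficient
  have s3 : bterm q a p 1 * (coeffNum q a p i / coeffDen q a p i) = -bterm q a p (p i / a) := by
    have n1 := nz0 hg.a_ne
    have n2 := nz0 (hap i)
    have n3 := nz0 hsq
    have n4 := nz0 (hg.p_ne i)
    have n5 : ∏ j ∈ Finset.univ.erase i, pochInf q (p j) ≠ 0 :=
      Finset.prod_ne_zero_iff.2 fun j _ => nz0 (hg.p_ne j)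
    have n6 : ∏ j ∈ Finset.univ.erase i, pochInf q (a * q / p j) ≠ 0 :=
      Finset.prod_ne_zero_iff.2 fun j _ => apq j
    have n7 : ∏ j ∈ Finset.univ.erase i, pochInf q (p i * p j / a) ≠ 0 :=
      Finset.prod_ne_zero_iff.2 fun j _ => nz0 (hg.pp_ne j)
    have n8 := nz1 (hap i)
    have n9 := nz1 hsq
    have n10 := nz1 hg.a_ne
    have hpi := hp i
    have hd : a - p i ≠ 0 := sub_ne_zero.2 fun h => by
      have := hg.pa_ne i 0
      rw [h, div_self hpi] at this
      simp at this
    have hd1 : a - p i ^ 2 ≠ 0 := fun h => h1u (by field_simp; simpa using h)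
    have hd2 : p i - a ≠ 0 := fun h => hd (by linear_combination -h)
    simp only [bterm, coeffNum, coeffDen, pochsInf, List.map_cons, List.map_nil, List.prod_cons,
      List.prod_nil, mul_one, hau, hau2, hpu, haqu, hqu, Finset.prod_mul_distrib, one_pow]
    simp only [hprod]
    -- The minus sign and the prefactor $x=p_i/a$ of `bterm` both come from
    -- $(1-p_i/a)/(1-a/p_i)=-p_i/a$.
    rw [pochInf_eq hq1 a, pochInf_eq hq1 (a / p i), pochInf_eq hq1 (p i / a),
      show p i * p i / a = p i ^ 2 / a by ring, pochInf_eq hq1 (p i ^ 2 / a),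
      show a / p i * q = a * q / p i by ring, show p i ^ 2 / a * q = p i ^ 2 * q / a by ring,
      show p i * q / p i = q by field_simp]
    rw [show a / p i * q = a * q / p i by ring] at n8
    rw [show p i ^ 2 / a * q = p i ^ 2 * q / a by ring] at n9
    generalize ∏ j ∈ Finset.univ.erase i, pochInf q (p j) = A1 at *
    generalize ∏ j ∈ Finset.univ.erase i, pochInf q (a * q / p j) = A2 at *
    generalize ∏ j ∈ Finset.univ.erase i, pochInf q (p i * p j / a) = A3 at *
    generalize ∏ j ∈ Finset.univ.erase i, pochInf q (p i * q / p j) = A4 at *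
    generalize pochInf q (a * q / p i) = A5 at *
    generalize pochInf q (p i ^ 2 * q / a) = A6 at *
    generalize pochInf q (p i / a * q) = A7 at *
    generalize pochInf q (a * q) = A8 at *
    generalize pochInf q (p i) = A9 at *
    generalize pochInf q q = A10 at *
    field_simp
    ring
  rw [Phi, mul_add, s1, ← mul_assoc, s3, neg_mul, s2, sub_eq_add_neg]

/-! ### The polynomial identity behind the contiguous relation -/

/-- The parameters $b,\dots,f$ enter only through their elementary symmetric functions, the fifth
being fixed by the balancing condition. Both sides are affine in the free variables `e1`, …, `e4`,
which keeps the verification by `ring` small. -/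
lemma contiguous_polynomial_symm {a q g h : ℂ} (ha : a ≠ 0) (hq : q ≠ 0) (hg : g ≠ 0) (hh : h ≠ 0)
    (h1 : g - h * q ≠ 0) (h2 : h - g * q ≠ 0) (e1 e2 e3 e4 x : ℂ) :
    (g - h) * (1 - a * q / (g * h)) * (1 - a * q / h) * (1 - a * q / g)
      * ((1 - a * x) * (1 - e1 * x + e2 * x ^ 2 - e3 * x ^ 3 + e4 * x ^ 4
            - a ^ 3 * q ^ 2 / (g * h) * x ^ 5) * (1 - g / q * x) * (1 - h / q * x)
        - (1 - x) * (1 - e4 * (g * h) / (a ^ 2 * q ^ 2) * x + e3 * (g * h) / (a * q ^ 2) * x ^ 2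
            - e2 * (g * h) / q ^ 2 * x ^ 3 + e1 * (a * g * h) / q ^ 2 * x ^ 4
            - a ^ 2 * g * h / q ^ 2 * x ^ 5) * (1 - a * q * x / g) * (1 - a * q * x / h))
    = x * (1 - a * x ^ 2) *
      (g * (1 - a * q / h) * (1 - a * q / g) * (1 - g / q)
          * (1 - e4 * h / (a ^ 2 * q) + e3 * h / (a * g) - e2 * h * q / g ^ 2
            + e1 * a * h * q ^ 2 / g ^ 3 - a ^ 2 * h * q ^ 3 / g ^ 4) / (1 - h * q / g)
          * ((1 - a * x / h) * (1 - h * x) * (1 - a * q * x / h) * (1 - h / q * x))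
        - h * (1 - a * q / g) * (1 - a * q / h) * (1 - h / q)
          * (1 - e4 * g / (a ^ 2 * q) + e3 * g / (a * h) - e2 * g * q / h ^ 2
            + e1 * a * g * q ^ 2 / h ^ 3 - a ^ 2 * g * q ^ 3 / h ^ 4) / (1 - g * q / h)
          * ((1 - a * x / g) * (1 - g * x) * (1 - a * q * x / g) * (1 - g / q * x))
        - (g * (1 - h) * (1 - a / h) * (1 - a * q / h)
            * (1 - e4 * h / (a ^ 2 * q) + e3 * h / (a * g) - e2 * h * q / g ^ 2
              + e1 * a * h * q ^ 2 / g ^ 3 - a ^ 2 * h * q ^ 3 / g ^ 4) / (1 - h * q / g)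
          - h * (1 - g) * (1 - a / g) * (1 - a * q / g)
            * (1 - e4 * g / (a ^ 2 * q) + e3 * g / (a * h) - e2 * g * q / h ^ 2
              + e1 * a * g * q ^ 2 / h ^ 3 - a ^ 2 * g * q ^ 3 / h ^ 4) / (1 - g * q / h)
          + a * q / h * (1 - h / g) * (1 - g * h / (a * q))
            * (1 - e1 + e2 - e3 + e4 - a ^ 3 * q ^ 2 / (g * h)))
          * ((1 - a * q * x / g) * (1 - a * q * x / h) * (1 - g / q * x) * (1 - h / q * x))) := by
  rw [show 1 - h * q / g = (g - h * q) / g by field_simp,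
    show 1 - g * q / h = (h - g * q) / h by field_simp]
  field_simp
  ring

/-- The coefficient of `Φ(g-, h+) - Φ` in the contiguous relation; that of `Φ(h-, g+) - Φ` results
on exchanging `g` and `h`. -/
noncomputable def shiftCoeff (q a b c d e f g h : ℂ) : ℂ :=
  g * (1 - h) * (1 - a / h) * (1 - a * q / h)
    * (1 - a * q / (g * b)) * (1 - a * q / (g * c)) * (1 - a * q / (g * d))
    * (1 - a * q / (g * e)) * (1 - a * q / (g * f)) / (1 - h * q / g)

/-- The coefficient of `-Φ` in the contiguous relation. -/
noncomputable def baseCoeff (q a b c d e f g h : ℂ) : ℂ :=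
  a * q / h * (1 - h / g) * (1 - g * h / (a * q))
    * (1 - b) * (1 - c) * (1 - d) * (1 - e) * (1 - f)

/-- `shiftCoeff` renormalized for `bterm`. -/
noncomputable def bshiftCoeff (q a b c d e f g h : ℂ) : ℂ :=
  g * (1 - a * q / h) * (1 - a * q / g) * (1 - g / q)
    * (1 - a * q / (g * b)) * (1 - a * q / (g * c)) * (1 - a * q / (g * d))
    * (1 - a * q / (g * e)) * (1 - a * q / (g * f)) / (1 - h * q / g)

noncomputable def certConst (q a g h : ℂ) : ℂ :=
  (g - h) * (1 - a * q / (g * h)) * (1 - a * q / h) * (1 - a * q / g)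

/-- Two expansions in the elementary symmetric functions of `b, c, d, e, f`. -/
lemma exists_quintic_coeffs {q a b c d e f g h : ℂ} (ha : a ≠ 0) (hq : q ≠ 0)
    (hb : b ≠ 0) (hc : c ≠ 0) (hd : d ≠ 0) (he : e ≠ 0) (hf : f ≠ 0)
    (bal : b * c * d * e * f * g * h = a ^ 3 * q ^ 2) :
    ∃ e1 e2 e3 e4 : ℂ,
      (∀ y : ℂ, (1 - b * y) * (1 - c * y) * (1 - d * y) * (1 - e * y) * (1 - f * y)
        = 1 - e1 * y + e2 * y ^ 2 - e3 * y ^ 3 + e4 * y ^ 4 - a ^ 3 * q ^ 2 / (g * h) * y ^ 5) ∧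
      (∀ y : ℂ, (1 - a * y / b) * (1 - a * y / c) * (1 - a * y / d) * (1 - a * y / e)
          * (1 - a * y / f)
        = 1 - e4 * (g * h) / (a ^ 2 * q ^ 2) * y + e3 * (g * h) / (a * q ^ 2) * y ^ 2
            - e2 * (g * h) / q ^ 2 * y ^ 3 + e1 * (a * g * h) / q ^ 2 * y ^ 4
            - a ^ 2 * g * h / q ^ 2 * y ^ 5) := by
  have hw : b * c * d * e * f ≠ 0 := by
    simp only [ne_eq, mul_eq_zero, not_or]
    exact ⟨⟨⟨⟨hb, hc⟩, hd⟩, he⟩, hf⟩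
  have hgh : g * h = a ^ 3 * q ^ 2 / (b * c * d * e * f) := by
    rw [eq_div_iff hw, ← bal]; ring
  refine ⟨b + c + d + e + f,
    b * c + b * d + b * e + b * f + c * d + c * e + c * f + d * e + d * f + e * f,
    b * c * d + b * c * e + b * c * f + b * d * e + b * d * f + b * e * f + c * d * e + c * d * f
      + c * e * f + d * e * f,
    b * c * d * e + b * c * d * f + b * c * e * f + b * d * e * f + c * d * e * f,
    fun y => ?_, fun y => ?_⟩
  · rw [hgh, div_div_cancel₀ (by simp [ha, hq])]
    ring
  · rw [mul_assoc a g h, mul_assoc (a ^ 2) g h, hgh]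
    field_simp
    ring

/-- Under $x\mapsto 1/(ax)$ the two products on the left are exchanged up to the factor $a^4x^8$, by
the balancing condition. So their difference is divisible by $x(1-ax^2)$, its $x^8$ terms cancel,
and the quotient is a self-reciprocal quartic. Such quartics form a three-dimensional space
containing the three products on the right. The coefficients are found at $x=q/g$ and $x=q/h$, where
two of the products vanish, and at $x=1$. -/
lemma contiguous_polynomial {q a b c d e f g h : ℂ} (ha : a ≠ 0) (hq : q ≠ 0)
    (hb : b ≠ 0) (hc : c ≠ 0) (hd : d ≠ 0) (he : e ≠ 0) (hf : f ≠ 0) (hg : g ≠ 0) (hh : h ≠ 0)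
    (bal : b * c * d * e * f * g * h = a ^ 3 * q ^ 2) (h1 : g ≠ h * q) (h2 : h ≠ g * q) (x : ℂ) :
    certConst q a g h
      * ((1 - a * x) * ((1 - b * x) * (1 - c * x) * (1 - d * x) * (1 - e * x) * (1 - f * x))
          * (1 - g / q * x) * (1 - h / q * x)
        - (1 - x) * ((1 - a * x / b) * (1 - a * x / c) * (1 - a * x / d) * (1 - a * x / e)
          * (1 - a * x / f)) * (1 - a * q * x / g) * (1 - a * q * x / h))
    = x * (1 - a * x ^ 2) *
      (bshiftCoeff q a b c d e f g h
          * ((1 - a * x / h) * (1 - h * x) * (1 - a * q * x / h) * (1 - h / q * x))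
        - bshiftCoeff q a b c d e f h g
          * ((1 - a * x / g) * (1 - g * x) * (1 - a * q * x / g) * (1 - g / q * x))
        - (shiftCoeff q a b c d e f g h - shiftCoeff q a b c d e f h g
            + baseCoeff q a b c d e f g h)
          * ((1 - a * q * x / g) * (1 - a * q * x / h) * (1 - g / q * x) * (1 - h / q * x))) := by
  obtain ⟨e1, e2, e3, e4, p1, p2⟩ := exists_quintic_coeffs ha hq hb hc hd he hf bal
  have key := contiguous_polynomial_symm ha hq hg hh (sub_ne_zero.2 h1) (sub_ne_zero.2 h2)
    e1 e2 e3 e4 x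
  have p3 : (1 - b) * (1 - c) * (1 - d) * (1 - e) * (1 - f)
      = 1 - e1 + e2 - e3 + e4 - a ^ 3 * q ^ 2 / (g * h) := by
    simpa only [mul_one, one_pow] using p1 1
  have p4 : (1 - a * q / (g * b)) * (1 - a * q / (g * c)) * (1 - a * q / (g * d))
      * (1 - a * q / (g * e)) * (1 - a * q / (g * f))
      = 1 - e4 * h / (a ^ 2 * q) + e3 * h / (a * g) - e2 * h * q / g ^ 2
            + e1 * a * h * q ^ 2 / g ^ 3 - a ^ 2 * h * q ^ 3 / g ^ 4 := by
    have := p2 (q / g)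
    simp only [← mul_div_assoc, div_div] at this
    rw [this]
    field_simp
  have p5 : (1 - a * q / (h * b)) * (1 - a * q / (h * c)) * (1 - a * q / (h * d))
      * (1 - a * q / (h * e)) * (1 - a * q / (h * f))
      = 1 - e4 * g / (a ^ 2 * q) + e3 * g / (a * h) - e2 * g * q / h ^ 2
            + e1 * a * g * q ^ 2 / h ^ 3 - a ^ 2 * g * q ^ 3 / h ^ 4 := by
    have := p2 (q / h)
    simp only [← mul_div_assoc, div_div] at this
    rw [this]
    field_simp
  rw [← p1 x, ← p2 x, ← p3, ← p4, ← p5] at key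
  unfold certConst bshiftCoeff shiftCoeff baseCoeff
  simp only [← mul_assoc] at key ⊢
  exact key

/-! ### The summands and their certificate over a common factor -/

/-- The part of `bterm` that does not involve the last two parameters. -/
noncomputable def bcore (q a b c d e f x : ℂ) : ℂ :=
  pochInf q (q * x) * (pochInf q (a * q * x / b) * pochInf q (a * q * x / c)
      * pochInf q (a * q * x / d) * pochInf q (a * q * x / e) * pochInf q (a * q * x / f))
    / (pochInf q (a * x) * (pochInf q (b * x) * pochInf q (c * x) * pochInf q (d * x)
      * pochInf q (e * x) * pochInf q (f * x)))

lemma bterm_eq_bcore (q a b c d e f g h x : ℂ) :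
    bterm q a ![b, c, d, e, f, g, h] x = x * (1 - a * x ^ 2) * bcore q a b c d e f x
      * (pochInf q (a * q * x / g) * pochInf q (a * q * x / h)
        / (pochInf q (g * x) * pochInf q (h * x))) := by
  simp only [bterm, bcore, Fin.prod_univ_seven, Matrix.cons_val]
  ring

/-- The common factor of the three summands. -/
noncomputable def bbase (q a b c d e f g h x : ℂ) : ℂ :=
  bcore q a b c d e f x * (pochInf q (a * q ^ 2 * x / g) * pochInf q (a * q ^ 2 * x / h)
    / (pochInf q (g / q * x) * pochInf q (h / q * x)))

/-- The function whose `q`-difference is the contiguous combination of summands. -/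
noncomputable def bcert (q a b c d e f g h x : ℂ) : ℂ :=
  certConst q a g h *
  (pochInf q x * (pochInf q (a * x / b) * pochInf q (a * x / c)
      * pochInf q (a * x / d) * pochInf q (a * x / e) * pochInf q (a * x / f))
      * pochInf q (a * q * x / g) * pochInf q (a * q * x / h)
    / (pochInf q (a * x) * (pochInf q (b * x) * pochInf q (c * x) * pochInf q (d * x)
      * pochInf q (e * x) * pochInf q (f * x)) * pochInf q (g / q * x) * pochInf q (h / q * x)))

lemma pochInf_of_eq_mul {q : ℂ} (hq1 : ‖q‖ < 1) {x y : ℂ} (h : y = x * q) :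
    pochInf q x = (1 - x) * pochInf q y := by rw [h, pochInf_eq hq1 x]

lemma bterm_eq_bbase {q a b c d e f g h : ℂ} (hq0 : q ≠ 0) (hq1 : ‖q‖ < 1)
    {x : ℂ} (hgx : pochInf q (g / q * x) ≠ 0) (hhx : pochInf q (h / q * x) ≠ 0) :
    bterm q a ![b, c, d, e, f, g, h] x = x * (1 - a * x ^ 2) * bbase q a b c d e f g h x
      * ((1 - a * q * x / g) * (1 - a * q * x / h) * (1 - g / q * x) * (1 - h / q * x)) := by
  rw [bterm_eq_bcore, bbase]
  rw [pochInf_of_eq_mul hq1 (show g * x = g / q * x * q by field_simp)] at hgx ⊢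
  rw [pochInf_of_eq_mul hq1 (show h * x = h / q * x * q by field_simp)] at hhx ⊢
  rw [pochInf_of_eq_mul hq1 (show a * q ^ 2 * x / g = a * q * x / g * q by ring),
    pochInf_of_eq_mul hq1 (show a * q ^ 2 * x / h = a * q * x / h * q by ring)]
  have n1 := left_ne_zero_of_mul hgx
  have n2 := right_ne_zero_of_mul hgx
  have n3 := left_ne_zero_of_mul hhx
  have n4 := right_ne_zero_of_mul hhx
  generalize 1 - g / q * x = A1 at *
  generalize 1 - h / q * x = A2 at *
  generalize 1 - a * q * x / g = A3 at *
  generalize 1 - a * q * x / h = A4 at *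
  generalize pochInf q (a * q ^ 2 * x / h) = A5 at *
  generalize pochInf q (a * q ^ 2 * x / g) = A6 at *
  field_simp

lemma bterm_shift_eq_bbase {q a b c d e f g h : ℂ} (hq0 : q ≠ 0)
    (hq1 : ‖q‖ < 1) {x : ℂ} (hhx : pochInf q (h / q * x) ≠ 0) :
    bterm q a ![b, c, d, e, f, g / q, h * q] x = x * (1 - a * x ^ 2) * bbase q a b c d e f g h x
      * ((1 - a * x / h) * (1 - h * x) * (1 - a * q * x / h) * (1 - h / q * x)) := by
  rw [bterm_eq_bcore, bbase]
  rw [pochInf_of_eq_mul hq1 (show h * x = h / q * x * q by field_simp),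
    pochInf_of_eq_mul hq1 (show h * q * x = h * x * q by ring)] at hhx ⊢
  rw [show a * q * x / (h * q) = a * x / h by field_simp,
    show a * q * x / (g / q) = a * q ^ 2 * x / g by field_simp,
    pochInf_of_eq_mul hq1 (show a * q * x / h = a * x / h * q by ring),
    pochInf_of_eq_mul hq1 (show a * q ^ 2 * x / h = a * q * x / h * q by ring)]
  have n3 := left_ne_zero_of_mul hhx
  have n4 := left_ne_zero_of_mul (right_ne_zero_of_mul hhx)
  generalize 1 - h * x = A1 at *
  generalize 1 - h / q * x = A2 at *
  generalize 1 - a * x / h = A3 at *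
  generalize 1 - a * q * x / h = A4 at *
  generalize pochInf q (a * q ^ 2 * x / h) = A5 at *
  generalize pochInf q (a * q ^ 2 * x / g) = A6 at *
  field_simp

lemma bbase_comm (q a b c d e f g h x : ℂ) : bbase q a b c d e f h g x = bbase q a b c d e f g h x := by
  unfold bbase
  rw [mul_comm (pochInf q (a * q ^ 2 * x / h)), mul_comm (pochInf q (h / q * x))]

lemma bterm_swap (q a b c d e f g h x : ℂ) :
    bterm q a ![b, c, d, e, f, g, h] x = bterm q a ![b, c, d, e, f, h, g] x := by
  rw [bterm_eq_bcore, bterm_eq_bcore, mul_comm (pochInf q (a * q * x / h)),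
    mul_comm (pochInf q (h * x))]

lemma bcert_eq_bbase {q : ℂ} (hq1 : ‖q‖ < 1) (a b c d e f g h x : ℂ) :
    bcert q a b c d e f g h x
    = certConst q a g h * bbase q a b c d e f g h x
      * ((1 - x) * ((1 - a * x / b) * (1 - a * x / c) * (1 - a * x / d) * (1 - a * x / e)
          * (1 - a * x / f)) * (1 - a * q * x / g) * (1 - a * q * x / h)) := by
  unfold bcert bbase bcore
  rw [pochInf_of_eq_mul hq1 (show q * x = x * q by ring),
    pochInf_of_eq_mul hq1 (show a * q * x / b = a * x / b * q by ring),
    pochInf_of_eq_mul hq1 (show a * q * x / c = a * x / c * q by ring),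
    pochInf_of_eq_mul hq1 (show a * q * x / d = a * x / d * q by ring),
    pochInf_of_eq_mul hq1 (show a * q * x / e = a * x / e * q by ring),
    pochInf_of_eq_mul hq1 (show a * q * x / f = a * x / f * q by ring),
    pochInf_of_eq_mul hq1 (show a * q ^ 2 * x / g = a * q * x / g * q by ring),
    pochInf_of_eq_mul hq1 (show a * q ^ 2 * x / h = a * q * x / h * q by ring)]
  ring

/-- Passing from $x$ to $xq$ drops the first factor of each infinite product in the denominator;
over `bbase` these factors reappear in the numerator. The nonvanishing hypotheses allow them to be
cancelled. -/
lemma bcert_mul_eq_bbase {q a b c d e f g h : ℂ} (hq1 : ‖q‖ < 1) {x : ℂ} (hax : pochInf q (a * x) ≠ 0)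
    (hbx : pochInf q (b * x) ≠ 0) (hcx : pochInf q (c * x) ≠ 0) (hdx : pochInf q (d * x) ≠ 0)
    (hex : pochInf q (e * x) ≠ 0) (hfx : pochInf q (f * x) ≠ 0)
    (hgx : pochInf q (g / q * x) ≠ 0) (hhx : pochInf q (h / q * x) ≠ 0) :
    bcert q a b c d e f g h (x * q)
    = certConst q a g h * bbase q a b c d e f g h x
      * ((1 - a * x) * ((1 - b * x) * (1 - c * x) * (1 - d * x) * (1 - e * x) * (1 - f * x))
          * (1 - g / q * x) * (1 - h / q * x)) := by
  unfold bcert bbase bcore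
  rw [pochInf_eq hq1] at hax hbx hcx hdx hex hfx hgx hhx
  rw [pochInf_eq hq1 (a * x), pochInf_eq hq1 (b * x), pochInf_eq hq1 (c * x),
    pochInf_eq hq1 (d * x), pochInf_eq hq1 (e * x), pochInf_eq hq1 (f * x),
    pochInf_eq hq1 (g / q * x), pochInf_eq hq1 (h / q * x)]
  have k : ∀ y : ℂ, a * q * x / y = a * (x * q) / y := fun y => by ring
  have k2 : ∀ y : ℂ, a * q ^ 2 * x / y = a * q * (x * q) / y := fun y => by ring
  have k3 : ∀ y : ℂ, y * x * q = y * (x * q) := fun y => by ring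
  simp only [k, k2, k3, mul_comm q x] at hax hbx hcx hdx hex hfx hgx hhx ⊢
  have m1 := left_ne_zero_of_mul hax
  have m2 := left_ne_zero_of_mul hbx
  have m3 := left_ne_zero_of_mul hcx
  have m4 := left_ne_zero_of_mul hdx
  have m5 := left_ne_zero_of_mul hex
  have m6 := left_ne_zero_of_mul hfx
  have m7 := left_ne_zero_of_mul hgx
  have m8 := left_ne_zero_of_mul hhx
  generalize 1 - a * x = B1 at *
  generalize 1 - b * x = B2 at *
  generalize 1 - c * x = B3 at *
  generalize 1 - d * x = B4 at *
  generalize 1 - e * x = B5 at *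
  generalize 1 - f * x = B6 at *
  generalize 1 - g / q * x = B7 at *
  generalize 1 - h / q * x = B8 at *
  generalize x * q = z
  generalize pochInf q z * (pochInf q (a * z / b) * pochInf q (a * z / c) * pochInf q (a * z / d)
    * pochInf q (a * z / e) * pochInf q (a * z / f)) = C1
  generalize pochInf q (a * q * z / g) = C2
  generalize pochInf q (a * q * z / h) = C3
  generalize pochInf q (a * z) = D1
  generalize pochInf q (b * z) = D2
  generalize pochInf q (c * z) = D3
  generalize pochInf q (d * z) = D4
  generalize pochInf q (e * z) = D5
  generalize pochInf q (f * z) = D6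
  generalize pochInf q (g / q * z) = D7
  generalize pochInf q (h / q * z) = D8
  have hB : B1 * (B2 * B3 * B4 * B5 * B6) * B7 * B8 ≠ 0 := by
    simp only [ne_eq, mul_eq_zero, not_or]
    exact ⟨⟨⟨m1, ⟨⟨⟨⟨m2, m3⟩, m4⟩, m5⟩, m6⟩⟩, m7⟩, m8⟩
  have hden : B1 * D1 * (B2 * D2 * (B3 * D3) * (B4 * D4) * (B5 * D5) * (B6 * D6))
      * (B7 * D7 * (B8 * D8))
      = D1 * (D2 * D3 * D4 * D5 * D6) * D7 * D8 * (B1 * (B2 * B3 * B4 * B5 * B6) * B7 * B8) := by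
    ring
  rw [div_mul_div_comm, hden, mul_assoc (certConst q a g h), div_mul_eq_mul_div,
    mul_div_mul_right _ _ hB, mul_assoc C1]

/-- All terms are polynomial multiples of `bbase`, so this is `contiguous_polynomial` times `bbase`.
-/
theorem bterm_contiguous {q a b c d e f g h : ℂ} (hq0 : q ≠ 0) (hq1 : ‖q‖ < 1) (ha : a ≠ 0)
    (hb : b ≠ 0) (hc : c ≠ 0) (hd : d ≠ 0) (he : e ≠ 0) (hf : f ≠ 0) (hg : g ≠ 0) (hh : h ≠ 0)
    (bal : b * c * d * e * f * g * h = a ^ 3 * q ^ 2) (h1 : g ≠ h * q) (h2 : h ≠ g * q)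
    {x : ℂ} (hax : pochInf q (a * x) ≠ 0)
    (hbx : pochInf q (b * x) ≠ 0) (hcx : pochInf q (c * x) ≠ 0) (hdx : pochInf q (d * x) ≠ 0)
    (hex : pochInf q (e * x) ≠ 0) (hfx : pochInf q (f * x) ≠ 0)
    (hgx : pochInf q (g / q * x) ≠ 0) (hhx : pochInf q (h / q * x) ≠ 0) :
    bshiftCoeff q a b c d e f g h * bterm q a ![b, c, d, e, f, g / q, h * q] x
      - bshiftCoeff q a b c d e f h g * bterm q a ![b, c, d, e, f, g * q, h / q] x
      - (shiftCoeff q a b c d e f g h - shiftCoeff q a b c d e f h g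
            + baseCoeff q a b c d e f g h) * bterm q a ![b, c, d, e, f, g, h] x
    = bcert q a b c d e f g h (x * q) - bcert q a b c d e f g h x := by
  have key := contiguous_polynomial ha hq0 hb hc hd he hf hg hh bal h1 h2 x
  rw [bcert_mul_eq_bbase hq1 hax hbx hcx hdx hex hfx hgx hhx, bcert_eq_bbase hq1,
    bterm_swap q a b c d e f (g * q), bterm_shift_eq_bbase hq0 hq1 hhx,
    bterm_shift_eq_bbase hq0 hq1 hgx, bterm_eq_bbase hq0 hq1 hgx hhx, bbase_comm q a b c d e f g h]
  generalize (1 - a * x) * ((1 - b * x) * (1 - c * x) * (1 - d * x) * (1 - e * x) * (1 - f * x))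
    * (1 - g / q * x) * (1 - h / q * x) = P1 at key ⊢
  generalize (1 - x) * ((1 - a * x / b) * (1 - a * x / c) * (1 - a * x / d) * (1 - a * x / e)
    * (1 - a * x / f)) * (1 - a * q * x / g) * (1 - a * q * x / h) = P2 at key ⊢
  generalize bbase q a b c d e f g h x = R at key ⊢
  generalize bshiftCoeff q a b c d e f g h = A1 at key ⊢
  generalize bshiftCoeff q a b c d e f h g = A2 at key ⊢
  generalize shiftCoeff q a b c d e f g h - shiftCoeff q a b c d e f h g
    + baseCoeff q a b c d e f g h = A3 at key ⊢
  generalize (1 - a * x / h) * (1 - h * x) * (1 - a * q * x / h) * (1 - h / q * x) = A4 at key ⊢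
  generalize (1 - a * x / g) * (1 - g * x) * (1 - a * q * x / g) * (1 - g / q * x) = A5 at key ⊢
  generalize (1 - a * q * x / g) * (1 - a * q * x / h) * (1 - g / q * x) * (1 - h / q * x) = A6 at key ⊢
  linear_combination -R * key

/-! ### Summation over a lattice -/

lemma tendsto_mul_pow_zero {q : ℂ} (hq1 : ‖q‖ < 1) (v : ℂ) :
    Tendsto (fun n : ℕ => v * q ^ n) atTop (𝓝 0) := by
  simpa using (tendsto_pow_atTop_nhds_zero_of_norm_lt_one hq1).const_mul v

/-- Since `bterm`$(x)/x$ is continuous at $0$, the terms are $O(q^n)$. No condition on `v` is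
needed, as only the behaviour near $0$ matters. -/
lemma summable_bterm {q : ℂ} (hq1 : ‖q‖ < 1) (a : ℂ) (p : Fin 7 → ℂ) (v : ℂ) :
    Summable fun n : ℕ => bterm q a p (v * q ^ n) := by
  have hc := continuous_pochInf hq1
  have hcont : ContinuousAt (fun x : ℂ => (1 - a * x ^ 2) * (pochInf q (q * x)
      * ∏ j, pochInf q (a * q * x / p j)) / (pochInf q (a * x) * ∏ j, pochInf q (p j * x))) 0 := by
    refine ContinuousAt.div (Continuous.continuousAt ?_) (Continuous.continuousAt ?_) ?_
    · exact (by fun_prop : Continuous fun x : ℂ => 1 - a * x ^ 2).mul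
        ((hc.comp (by fun_prop)).mul (continuous_finsetProd _ fun j _ => hc.comp (by fun_prop)))
    · exact (hc.comp (by fun_prop)).mul
        (continuous_finsetProd _ fun j _ => hc.comp (by fun_prop))
    · simp [pochInf_zero]
  have hlim := hcont.tendsto.comp (tendsto_mul_pow_zero hq1 v)
  have hO := (hlim.isBigO_one ℂ).mul
    (Asymptotics.isBigO_refl (fun n : ℕ => v * q ^ n) atTop)
  have hs : Summable fun n : ℕ => ‖(1 : ℂ) * (v * q ^ n)‖ := by
    simp only [one_mul]
    simpa using summable_norm_mul_pow hq1 v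
  refine summable_of_isBigO_nat hs (hO.norm_right.congr_left fun n => ?_)
  simp only [Function.comp, bterm]
  ring

lemma tendsto_bcert {q : ℂ} (hq1 : ‖q‖ < 1) (a b c d e f g h v : ℂ) :
    Tendsto (fun n : ℕ => bcert q a b c d e f g h (v * q ^ n)) atTop (𝓝 (certConst q a g h)) := by
  have hc := continuous_pochInf hq1
  have hcont : ContinuousAt (bcert q a b c d e f g h) 0 := by
    unfold bcert
    refine continuousAt_const.mul (ContinuousAt.div ?_ ?_ (by simp [pochInf_zero]))
    · refine Continuous.continuousAt ?_
      fun_prop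
    · refine Continuous.continuousAt ?_
      fun_prop
  have hlim := hcont.tendsto.comp (tendsto_mul_pow_zero hq1 v)
  have h0 : bcert q a b c d e f g h 0 = certConst q a g h := by simp [bcert, pochInf_zero]
  rwa [h0] at hlim

lemma pochInf_mul_pow_ne_zero {q : ℂ} (hq1 : ‖q‖ < 1) {y v : ℂ} (h : pochInf q (y * v) ≠ 0)
    (n : ℕ) : pochInf q (y * (v * q ^ n)) ≠ 0 := by
  rw [← poch_mul_pochInf hq1 _ n] at h
  rw [← mul_assoc]
  exact right_ne_zero_of_mul h

/-- The contiguous relation for sums over one lattice. -/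
theorem tsum_bterm_contiguous {q a b c d e f g h : ℂ} (hq0 : q ≠ 0) (hq1 : ‖q‖ < 1) (ha : a ≠ 0)
    (hb : b ≠ 0) (hc : c ≠ 0) (hd : d ≠ 0) (he : e ≠ 0) (hf : f ≠ 0) (hg : g ≠ 0) (hh : h ≠ 0)
    (bal : b * c * d * e * f * g * h = a ^ 3 * q ^ 2) (h1 : g ≠ h * q) (h2 : h ≠ g * q)
    {x : ℂ} (hax : pochInf q (a * x) ≠ 0)
    (hbx : pochInf q (b * x) ≠ 0) (hcx : pochInf q (c * x) ≠ 0) (hdx : pochInf q (d * x) ≠ 0)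
    (hex : pochInf q (e * x) ≠ 0) (hfx : pochInf q (f * x) ≠ 0)
    (hgx : pochInf q (g / q * x) ≠ 0) (hhx : pochInf q (h / q * x) ≠ 0)
    (hx : bcert q a b c d e f g h x = 0) :
    bshiftCoeff q a b c d e f g h
        * ∑' n : ℕ, bterm q a ![b, c, d, e, f, g / q, h * q] (x * q ^ n)
      - bshiftCoeff q a b c d e f h g
        * ∑' n : ℕ, bterm q a ![b, c, d, e, f, g * q, h / q] (x * q ^ n)
      - (shiftCoeff q a b c d e f g h - shiftCoeff q a b c d e f h g
            + baseCoeff q a b c d e f g h)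
        * ∑' n : ℕ, bterm q a ![b, c, d, e, f, g, h] (x * q ^ n)
    = certConst q a g h := by
  have hs := (((summable_bterm hq1 a ![b, c, d, e, f, g / q, h * q] x).hasSum.mul_left
      (bshiftCoeff q a b c d e f g h)).sub
    ((summable_bterm hq1 a ![b, c, d, e, f, g * q, h / q] x).hasSum.mul_left
      (bshiftCoeff q a b c d e f h g))).sub
    ((summable_bterm hq1 a ![b, c, d, e, f, g, h] x).hasSum.mul_left
      (shiftCoeff q a b c d e f g h - shiftCoeff q a b c d e f h g
            + baseCoeff q a b c d e f g h))
  refine tendsto_nhds_unique hs.tendsto_sum_nat ?_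
  have ht : ∀ n : ℕ, ∑ k ∈ Finset.range n, (bshiftCoeff q a b c d e f g h
          * bterm q a ![b, c, d, e, f, g / q, h * q] (x * q ^ k)
        - bshiftCoeff q a b c d e f h g * bterm q a ![b, c, d, e, f, g * q, h / q] (x * q ^ k)
        - (shiftCoeff q a b c d e f g h - shiftCoeff q a b c d e f h g
            + baseCoeff q a b c d e f g h) * bterm q a ![b, c, d, e, f, g, h] (x * q ^ k))
      = bcert q a b c d e f g h (x * q ^ n) := fun n => by
    rw [Finset.sum_congr rfl fun k _ => bterm_contiguous hq0 hq1 ha hb hc hd he hf hg hh bal h1 h2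
      (pochInf_mul_pow_ne_zero hq1 hax k) (pochInf_mul_pow_ne_zero hq1 hbx k)
      (pochInf_mul_pow_ne_zero hq1 hcx k) (pochInf_mul_pow_ne_zero hq1 hdx k)
      (pochInf_mul_pow_ne_zero hq1 hex k) (pochInf_mul_pow_ne_zero hq1 hfx k)
      (pochInf_mul_pow_ne_zero hq1 hgx k) (pochInf_mul_pow_ne_zero hq1 hhx k)]
    -- The sum telescopes, and `hx` removes the boundary term at the start of the lattice.
    have := Finset.sum_range_sub (fun k : ℕ => bcert q a b c d e f g h (x * q ^ k)) n
    simp only [pow_succ, ← mul_assoc, pow_zero, mul_one, hx, sub_zero] at this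
    exact this
  simp only [ht]
  exact tendsto_bcert hq1 a b c d e f g h x

/-! ### Moving the starting point of a lattice -/

lemma bterm_eq_zero_of_base {q : ℂ} (hq0 : q ≠ 0) (hq1 : ‖q‖ < 1) (a : ℂ) (p : Fin 7 → ℂ) :
    bterm q a p q⁻¹ = 0 := by
  have : pochInf q (q * q⁻¹) = 0 := pochInf_eq_zero hq1 0 (by simp [hq0])
  simp [bterm, this]

lemma bterm_eq_zero_of_param {q : ℂ} (hq0 : q ≠ 0) (hq1 : ‖q‖ < 1) {a : ℂ} (ha : a ≠ 0)
    (p : Fin 7 → ℂ) (i : Fin 7) (hp : p i ≠ 0) (k : ℕ) :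
    bterm q a p (p i / a * q⁻¹ ^ (k + 1)) = 0 := by
  have : ∏ j, pochInf q (a * q * (p i / a * q⁻¹ ^ (k + 1)) / p j) = 0 :=
    Finset.prod_eq_zero (Finset.mem_univ i) (pochInf_eq_zero hq1 k (by
      rw [pow_succ, inv_pow]; field_simp))
  rw [bterm, this]
  simp

lemma tsum_bterm_shift {q : ℂ} (hq0 : q ≠ 0) (hq1 : ‖q‖ < 1) (a : ℂ) (p : Fin 7 → ℂ) (x : ℂ)
    (h : bterm q a p (x * q⁻¹) = 0) :
    ∑' n : ℕ, bterm q a p (x * q⁻¹ * q ^ n) = ∑' n : ℕ, bterm q a p (x * q ^ n) := by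
  rw [(summable_bterm hq1 a p (x * q⁻¹)).tsum_eq_zero_add, pow_zero, mul_one, h, zero_add]
  refine tsum_congr fun n => ?_
  rw [pow_succ', mul_assoc x, inv_mul_cancel_left₀ hq0]

/-- If the distinguished parameter is one of the last two, it changes by a factor $q^{\pm1}$ and the
second lattices of the three pairs start at different points. As `bterm` vanishes just before its
lattice, all three sums may start at $uq^{-1}$. -/
lemma tsum_bterm_param {q : ℂ} (hq0 : q ≠ 0) (hq1 : ‖q‖ < 1) {a : ℂ} (ha : a ≠ 0)
    (p : Fin 7 → ℂ) (i : Fin 7) (hp : p i ≠ 0) {u : ℂ}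
    (hu : p i / a = u * q⁻¹ ∨ p i / a = u ∨ p i / a = u * q) :
    ∑' n : ℕ, bterm q a p (p i / a * q ^ n) = ∑' n : ℕ, bterm q a p (u * q⁻¹ * q ^ n) := by
  have hz := bterm_eq_zero_of_param hq0 hq1 ha p i hp
  rcases hu with hu | hu | hu
  · rw [hu]
  · rw [← hu, tsum_bterm_shift hq0 hq1]
    simpa using hz 0
  · have hu' : u = p i / a * q⁻¹ := by rw [hu]; field_simp
    rw [hu', tsum_bterm_shift hq0 hq1, tsum_bterm_shift hq0 hq1]
    · simpa using hz 0
    · simpa [pow_succ, mul_assoc] using hz 1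

/-! ### The contiguous relation at generic parameters -/

lemma Generic.of_zpow {q : ℂ} (hq0 : q ≠ 0) {i : Fin 7} {a : ℂ} {p p' : Fin 7 → ℂ}
    (hg : Generic q i a p) (ε : Fin 7 → ℤ) (h : ∀ j, p' j = p j * q ^ ε j) :
    Generic q i a p' := by
  have aux : ∀ x : ℂ, (∀ k : ℤ, x ≠ q ^ k) → ∀ m k : ℤ, x * q ^ m ≠ q ^ k := fun x hx m k hk => by
    apply hx (k - m)
    rw [zpow_sub₀ hq0, ← hk, mul_div_assoc, div_self (zpow_ne_zero _ hq0), mul_one]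
  refine ⟨hg.a_ne_zero, fun j => ?_, hg.a_ne, fun j k => ?_, fun j k => ?_, fun j k => ?_,
    fun j hj k => ?_⟩
  · rw [h]
    exact mul_ne_zero (hg.p_ne_zero j) (zpow_ne_zero _ hq0)
  · rw [h]
    exact aux _ (hg.p_ne j) _ _
  · rw [h, h, show p i * q ^ ε i * (p j * q ^ ε j) / a = p i * p j / a * q ^ (ε i + ε j) by
      rw [zpow_add₀ hq0]; ring]
    exact aux _ (hg.pp_ne j) _ _
  · rw [h, mul_div_right_comm]
    exact aux _ (hg.pa_ne j) _ _
  · rw [h, h, show p i * q ^ ε i / (p j * q ^ ε j) = p i / p j * q ^ (ε i - ε j) by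
      rw [zpow_sub₀ hq0]; ring]
    exact aux _ (hg.quot_ne j hj) _ _

lemma Generic.bterm_one_ne_zero {q : ℂ} (hq0 : q ≠ 0) (hq1 : ‖q‖ < 1) {i : Fin 7} {a : ℂ}
    {p : Fin 7 → ℂ} (hg : Generic q i a p) : bterm q a p 1 ≠ 0 := by
  have nz := fun {x : ℂ} (hx : ∀ k : ℤ, x ≠ q ^ k) => pochInf_mul_zpow_ne_zero hq0 hq1 hx
  have n1 : (1 : ℂ) - a ≠ 0 := sub_ne_zero.2 (by simpa using (hg.a_ne 0).symm)
  have n2 : pochInf q q ≠ 0 := pochInf_ne_zero hq1 (pow_succ_ne_one hq1)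
  have n3 : ∏ j, pochInf q (a * q / p j) ≠ 0 := Finset.prod_ne_zero_iff.2 fun j _ => by
    have := nz (ne_zpow_inv (hg.pa_ne j)) 1
    rwa [zpow_one, div_mul_eq_mul_div] at this
  have n4 : ∏ j, pochInf q (p j) ≠ 0 := Finset.prod_ne_zero_iff.2 fun j _ => by
    simpa using nz (hg.p_ne j) 0
  have n5 : pochInf q a ≠ 0 := by simpa using nz hg.a_ne 0
  simp only [bterm, mul_one, one_pow, one_mul]
  exact div_ne_zero (mul_ne_zero n1 (mul_ne_zero n2 n3)) (mul_ne_zero n5 n4)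

/-- Accounts for the different normalizations `bterm`$(1)$ of the pairs: it turns coefficients of
lattice sums into coefficients of $\Phi$. -/
lemma bshiftCoeff_mul_aux (q a b c d e f g h x S R : ℂ) :
    bshiftCoeff q a b c d e f g h
      * (x * S * R * ((1 - a / h) * (1 - h) * (1 - a * q / h) * (1 - h / q)))
    = shiftCoeff q a b c d e f g h
      * (x * S * R * ((1 - a * q / g) * (1 - a * q / h) * (1 - g / q) * (1 - h / q))) := by
  unfold bshiftCoeff shiftCoeff
  generalize 1 - h = A1
  generalize 1 - a / h = A2
  generalize 1 - a * q / h = A3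
  generalize 1 - a * q / g = A4
  generalize 1 - g / q = A5
  generalize 1 - h / q = A6
  generalize 1 - h * q / g = A7
  generalize 1 - a * q / (g * b) = A8
  generalize 1 - a * q / (g * c) = A9
  generalize 1 - a * q / (g * d) = A10
  generalize 1 - a * q / (g * e) = A11
  generalize 1 - a * q / (g * f) = A12
  ring

/-- The same constant `C` occurs for both lattices and drops out of the difference. -/
lemma contiguous_combine {N Nm Np F Fm Fp S Sm Sp S' Sm' Sp' γ₁ γ₂ c₁ c₂ c₃ C : ℂ} (hN : N ≠ 0)
    (s0 : N * F = S - S') (sm : Nm * Fm = Sm - Sm') (sp : Np * Fp = Sp - Sp')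
    (t1 : γ₁ * Sm - γ₂ * Sp - (c₁ - c₂ + c₃) * S = C)
    (t2 : γ₁ * Sm' - γ₂ * Sp' - (c₁ - c₂ + c₃) * S' = C)
    (r1 : γ₁ * Nm = c₁ * N) (r2 : γ₂ * Np = c₂ * N) :
    c₁ * (Fm - F) - c₂ * (Fp - F) - c₃ * F = 0 := by
  apply mul_left_cancel₀ hN
  linear_combination -Fm * r1 + Fp * r2 + γ₁ * sm - γ₂ * sp - (c₁ - c₂ + c₃) * s0 + t1 - t2

/-- The contiguous relation, with the coefficients abbreviated, at generic parameters. -/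
theorem Phi_contiguous_of_generic {q : ℂ} (hq0 : q ≠ 0) (hq1 : ‖q‖ < 1) {i : Fin 7}
    {a b c d e f g h : ℂ} (hgen : Generic q i a ![b, c, d, e, f, g, h])
    (bal : b * c * d * e * f * g * h = a ^ 3 * q ^ 2) (h1 : g ≠ h * q) (h2 : h ≠ g * q) :
    shiftCoeff q a b c d e f g h
        * (Phi q i a ![b, c, d, e, f, g / q, h * q] - Phi q i a ![b, c, d, e, f, g, h])
      - shiftCoeff q a b c d e f h g
        * (Phi q i a ![b, c, d, e, f, g * q, h / q] - Phi q i a ![b, c, d, e, f, g, h])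
      - baseCoeff q a b c d e f g h * Phi q i a ![b, c, d, e, f, g, h] = 0 := by
  have gm : Generic q i a ![b, c, d, e, f, g / q, h * q] :=
    hgen.of_zpow hq0 ![0, 0, 0, 0, 0, -1, 1] fun j => by
      fin_cases j <;> simp [div_eq_mul_inv]
  have gp : Generic q i a ![b, c, d, e, f, g * q, h / q] :=
    hgen.of_zpow hq0 ![0, 0, 0, 0, 0, 1, -1] fun j => by
      fin_cases j <;> simp [div_eq_mul_inv]
  have ha := hgen.a_ne_zero
  have hp := hgen.p_ne_zero
  have hb : b ≠ 0 := hp 0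
  have hc : c ≠ 0 := hp 1
  have hd : d ≠ 0 := hp 2
  have he : e ≠ 0 := hp 3
  have hf : f ≠ 0 := hp 4
  have hg : g ≠ 0 := hp 5
  have hh : h ≠ 0 := hp 6
  have nz := fun {x : ℂ} (hx : ∀ k : ℤ, x ≠ q ^ k) => pochInf_mul_zpow_ne_zero hq0 hq1 hx
  -- the two lattices
  have t1 := tsum_bterm_contiguous hq0 hq1 ha hb hc hd he hf hg hh bal h1 h2 (x := q⁻¹)
    (by simpa using nz hgen.a_ne (-1)) (by simpa using nz (hgen.p_ne 0) (-1))
    (by simpa using nz (hgen.p_ne 1) (-1)) (by simpa using nz (hgen.p_ne 2) (-1))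
    (by simpa using nz (hgen.p_ne 3) (-1)) (by simpa using nz (hgen.p_ne 4) (-1))
    (by
      have := nz (hgen.p_ne 5) (-2)
      rwa [show (![b, c, d, e, f, g, h] : Fin 7 → ℂ) 5 * q ^ (-2 : ℤ) = g / q * q⁻¹ by
        rw [zpow_neg]; simp; field_simp] at this)
    (by
      have := nz (hgen.p_ne 6) (-2)
      rwa [show (![b, c, d, e, f, g, h] : Fin 7 → ℂ) 6 * q ^ (-2 : ℤ) = h / q * q⁻¹ by
        rw [zpow_neg]; simp; field_simp] at this)
    (by
      have : pochInf q q⁻¹ = 0 := pochInf_eq_zero hq1 1 (by simp [hq0])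
      simp [bcert, this])
  set u := (![b, c, d, e, f, g, h] : Fin 7 → ℂ) i / a with hu
  have hpu : ∀ j, pochInf q ((![b, c, d, e, f, g, h] : Fin 7 → ℂ) j * (u * q⁻¹)) ≠ 0 :=
    fun j => by
    have := nz (hgen.pp_ne j) (-1)
    rw [zpow_neg_one] at this
    rwa [hu, show ∀ x y : ℂ, x * (y / a * q⁻¹) = y * x / a * q⁻¹ from fun x y => by ring]
  have hpu2 : ∀ j, pochInf q ((![b, c, d, e, f, g, h] : Fin 7 → ℂ) j / q * (u * q⁻¹)) ≠ 0 :=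
    fun j => by
    have := nz (hgen.pp_ne j) (-2)
    rw [zpow_neg] at this
    rwa [hu, show ∀ x y : ℂ, x / q * (y / a * q⁻¹) = y * x / a * (q ^ (2 : ℤ))⁻¹ from
      fun x y => by field_simp]
  have t2 := tsum_bterm_contiguous hq0 hq1 ha hb hc hd he hf hg hh bal h1 h2 (x := u * q⁻¹)
    (by
      have := nz (hgen.p_ne i) (-1)
      rw [zpow_neg_one] at this
      rwa [hu, ← mul_assoc, mul_div_cancel₀ _ ha])
    (hpu 0) (hpu 1) (hpu 2) (hpu 3) (hpu 4) (hpu2 5) (hpu2 6)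
    (by
      -- The start $uq^{-1}$ is a zero of `bcert` for every `i`: its numerator contains
      -- $(ax/y)_\infty$ for $y=b,\dots,f$, with argument $q^{-1}$ there, but $(aqx/y)_\infty$ for
      -- $y=g,h$, with argument $1$. For the last two, $u$ itself would not do.
      have z1 : ∀ y : ℂ, y ≠ 0 → pochInf q (a * (y / a * q⁻¹) / y) = 0 := fun y hy =>
        pochInf_eq_zero hq1 1 (by field_simp)
      have z2 : ∀ y : ℂ, y ≠ 0 → pochInf q (a * q * (y / a * q⁻¹) / y) = 0 := fun y hy =>
        pochInf_eq_zero hq1 0 (by field_simp)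
      rw [hu]
      clear_value u
      clear t1 hpu hpu2 hu
      fin_cases i
      · simp [bcert, z1 b hb]
      · simp [bcert, z1 c hc]
      · simp [bcert, z1 d hd]
      · simp [bcert, z1 e he]
      · simp [bcert, z1 f hf]
      · simp [bcert, z2 g hg]
      · simp [bcert, z2 h hh])
  -- the pairs
  have s0 := bterm_one_mul_Phi hq0 hq1 hgen
  have sm := bterm_one_mul_Phi hq0 hq1 gm
  have sp := bterm_one_mul_Phi hq0 hq1 gp
  have base : ∀ p : Fin 7 → ℂ, ∑' n : ℕ, bterm q a p (q ^ n)
      = ∑' n : ℕ, bterm q a p (q⁻¹ * q ^ n) := fun p => by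
    have := tsum_bterm_shift hq0 hq1 a p 1 (by simpa using bterm_eq_zero_of_base hq0 hq1 a p)
    simpa using this.symm
  rw [base, tsum_bterm_param hq0 hq1 ha _ i (hgen.p_ne_zero i) (u := u) (Or.inr (Or.inl rfl))] at s0
  rw [base, tsum_bterm_param hq0 hq1 ha _ i (gm.p_ne_zero i) (u := u) (by
    rw [hu]
    clear_value u
    clear t1 t2 s0 sm sp hpu hpu2 hu
    fin_cases i <;> simp [div_eq_mul_inv, mul_right_comm])] at sm
  rw [base, tsum_bterm_param hq0 hq1 ha _ i (gp.p_ne_zero i) (u := u) (by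
    rw [hu]
    clear_value u
    clear t1 t2 s0 sm sp hpu hpu2 hu
    fin_cases i <;> simp [div_eq_mul_inv, mul_right_comm])] at sp
  have hg1 : pochInf q (g / q * 1) ≠ 0 := by
    simpa [div_eq_mul_inv] using nz (hgen.p_ne 5) (-1)
  have hh1 : pochInf q (h / q * 1) ≠ 0 := by
    simpa [div_eq_mul_inv] using nz (hgen.p_ne 6) (-1)
  -- Ratio of the normalizations of the shifted and unshifted pairs, read off over `bbase` at $x=1$.
  have r1 : bshiftCoeff q a b c d e f g h * bterm q a ![b, c, d, e, f, g / q, h * q] 1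
      = shiftCoeff q a b c d e f g h * bterm q a ![b, c, d, e, f, g, h] 1 := by
    rw [bterm_shift_eq_bbase hq0 hq1 hh1, bterm_eq_bbase hq0 hq1 hg1 hh1]
    simp only [mul_one]
    exact bshiftCoeff_mul_aux _ _ _ _ _ _ _ _ _ _ _ _
  have r2 : bshiftCoeff q a b c d e f h g * bterm q a ![b, c, d, e, f, g * q, h / q] 1
      = shiftCoeff q a b c d e f h g * bterm q a ![b, c, d, e, f, g, h] 1 := by
    rw [bterm_swap q a b c d e f (g * q), bterm_swap q a b c d e f g h,
      bterm_shift_eq_bbase hq0 hq1 hg1, bterm_eq_bbase hq0 hq1 hh1 hg1]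
    simp only [mul_one]
    exact bshiftCoeff_mul_aux _ _ _ _ _ _ _ _ _ _ _ _
  exact contiguous_combine (hgen.bterm_one_ne_zero hq0 hq1) s0 sm sp t1 t2 r1 r2

/-! ### Continuity of the complementary pair at regular points -/

/-- A bound for all shifted factorials `(x q^m)_n`. -/
noncomputable def pochBound (q x : ℂ) : ℝ := Real.exp (‖x‖ / (1 - ‖q‖))

lemma pochBound_pos (q x : ℂ) : 0 < pochBound q x := Real.exp_pos _

lemma continuous_pochBound (q : ℂ) : Continuous (pochBound q) := by
  unfold pochBound
  fun_prop

/-- $1/(y)_n=(yq^n)_\infty/(y)_\infty$, and the numerator is bounded uniformly in `n`. -/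
lemma norm_inv_poch_le {q : ℂ} (hq1 : ‖q‖ < 1) {y : ℂ} (hy : pochInf q y ≠ 0) (n : ℕ) :
    ‖(poch q y n)⁻¹‖ ≤ pochBound q y / ‖pochInf q y‖ := by
  have h := poch_mul_pochInf hq1 y n
  have h1 : poch q y n ≠ 0 := left_ne_zero_of_mul (h ▸ hy)
  have h2 : (poch q y n)⁻¹ = pochInf q (y * q ^ n) / pochInf q y := by
    rw [← h]
    have := right_ne_zero_of_mul (h ▸ hy)
    field_simp
  rw [h2, norm_div]
  gcongr
  refine (norm_pochInf_le hq1 _).trans (Real.exp_le_exp.2 ?_)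
  have : 0 < 1 - ‖q‖ := by linarith
  gcongr
  rw [norm_mul, norm_pow]
  exact mul_le_of_le_one_right (norm_nonneg _) (pow_le_one₀ (norm_nonneg _) hq1.le)

/-- A constant that bounds the terms of the very-well-poised series relative to `q ^ n`. -/
noncomputable def wbound (q a : ℂ) (p : Fin 7 → ℂ) : ℝ :=
  (1 + ‖a‖) * (pochBound q a * ∏ j, pochBound q (p j))
    * (‖(1 - a)⁻¹‖ * (pochBound q q / ‖pochInf q q‖
      * ∏ j, pochBound q (a * q / p j) / ‖pochInf q (a * q / p j)‖))

lemma norm_wterm_le {q : ℂ} (hq1 : ‖q‖ < 1) {a : ℂ} {p : Fin 7 → ℂ}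
    (hp : ∀ j, pochInf q (a * q / p j) ≠ 0) (n : ℕ) :
    ‖wterm q a p n‖ ≤ wbound q a p * ‖q‖ ^ n := by
  have hqq : pochInf q q ≠ 0 := pochInf_ne_zero hq1 (pow_succ_ne_one hq1)
  have e : wterm q a p n = q ^ n * ((1 - a * q ^ (2 * n)) * (poch q a n * ∏ j, poch q (p j) n)
      * ((1 - a)⁻¹ * ((poch q q n)⁻¹ * ∏ j, (poch q (a * q / p j) n)⁻¹))) := by
    rw [wterm, Finset.prod_inv_distrib]
    simp only [div_eq_mul_inv, mul_inv]
    ring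
  rw [e, norm_mul, norm_pow, mul_comm]
  gcongr
  simp only [norm_mul, norm_prod, wbound]
  have h1 : ‖1 - a * q ^ (2 * n)‖ ≤ 1 + ‖a‖ := by
    refine (norm_sub_le _ _).trans ?_
    rw [norm_one, norm_mul, norm_pow]
    gcongr
    exact mul_le_of_le_one_right (norm_nonneg _) (pow_le_one₀ (norm_nonneg _) hq1.le)
  have h0 : ∀ x, 0 ≤ pochBound q x := fun x => (pochBound_pos q x).le
  have hb : ∀ x, ‖poch q x n‖ ≤ pochBound q x := fun x => norm_poch_le hq1 x n
  gcongr
  · exact mul_nonneg (by positivity) (mul_nonneg (h0 _) (Finset.prod_nonneg fun _ _ => h0 _))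
  · exact h0 _
  · exact hb _
  · exact hb _
  · exact div_nonneg (h0 _) (norm_nonneg _)
  · exact norm_inv_poch_le hq1 hqq n
  · exact norm_inv_poch_le hq1 (hp _) n

/-- Dominated convergence: `wbound` depends continuously on the parameters, so near the limit its
limiting value plus one serves as a common constant in a geometric majorant. -/
lemma tendsto_W {α : Type*} {l : Filter α} {q : ℂ} (hq0 : q ≠ 0) (hq1 : ‖q‖ < 1)
    {A : α → ℂ} {P : α → Fin 7 → ℂ} {a : ℂ} {p : Fin 7 → ℂ} (hA : Tendsto A l (𝓝 a))
    (hP : ∀ j, Tendsto (fun t => P t j) l (𝓝 (p j))) (hp : ∀ j, p j ≠ 0)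
    (ha : ∀ k : ℕ, a * q ^ (2 * k) ≠ 1) (hap : ∀ j, pochInf q (a * q / p j) ≠ 0)
    (hev : ∀ᶠ t in l, ∀ k : ℕ, A t * q ^ (2 * k) ≠ 1) :
    Tendsto (fun t => W q (A t) (P t)) l (𝓝 (W q a p)) := by
  have hc := continuous_pochInf hq1
  have hB := continuous_pochBound q
  have h1a : 1 - a ≠ 0 := sub_ne_zero.2 (by simpa using (ha 0).symm)
  have hqq : pochInf q q ≠ 0 := pochInf_ne_zero hq1 (pow_succ_ne_one hq1)
  have hAP : ∀ j, Tendsto (fun t => A t * q / P t j) l (𝓝 (a * q / p j)) := fun j =>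
    (hA.mul_const q).div (hP j) (hp j)
  have hD : ∀ j, Tendsto (fun t => pochInf q (A t * q / P t j)) l
      (𝓝 (pochInf q (a * q / p j))) := fun j => (hc.tendsto _).comp (hAP j)
  have hwb : Tendsto (fun t => wbound q (A t) (P t)) l (𝓝 (wbound q a p)) := by
    unfold wbound
    refine ((hA.norm.const_add 1).mul (((hB.tendsto _).comp hA).mul
      (tendsto_finsetProd _ fun j _ => (hB.tendsto _).comp (hP j)))).mul
      (((hA.const_sub 1).inv₀ h1a).norm.mul (tendsto_const_nhds.mul
      (tendsto_finsetProd _ fun j _ => ((hB.tendsto _).comp (hAP j)).div (hD j).norm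
        (norm_ne_zero_iff.2 (hap j)))))
  rw [W_eq_tsum ha]
  refine Tendsto.congr' (hev.mono fun t ht => (W_eq_tsum ht (P t)).symm) ?_
  refine tendsto_tsum_of_dominated_convergence (bound := fun n => (wbound q a p + 1) * ‖q‖ ^ n)
    ((summable_geometric_of_lt_one (norm_nonneg q) hq1).mul_left _) (fun n => ?_) ?_
  · have hcp := fun y => (continuous_poch q n).tendsto y
    unfold wterm
    refine Tendsto.div ?_ ?_ ?_
    · exact (tendsto_const_nhds.mul ((hA.mul_const _).const_sub 1)).mul (((hcp _).comp hA).mul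
        (tendsto_finsetProd _ fun j _ => (hcp _).comp (hP j)))
    · exact (hA.const_sub 1).mul (tendsto_const_nhds.mul
        (tendsto_finsetProd _ fun j _ => (hcp _).comp (hAP j)))
    · refine mul_ne_zero h1a (mul_ne_zero
        (poch_ne_zero (pow_succ_ne_one hq1) n) (Finset.prod_ne_zero_iff.2 fun j _ => ?_))
      exact poch_ne_zero (mul_pow_ne_one_of_pochInf_ne_zero hq1 (hap j)) n
  · have h1 : ∀ᶠ t in l, ∀ j, pochInf q (A t * q / P t j) ≠ 0 :=
      eventually_all.2 fun j => (hD j).eventually_ne (hap j)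
    have h2 := hwb.eventually_lt_const (lt_add_one (wbound q a p))
    filter_upwards [h1, h2] with t ht1 ht2 n
    refine (norm_wterm_le hq1 ht1 n).trans ?_
    gcongr

lemma mul_pow_ne_one_of_lowerW {q a : ℂ} {p : Fin 7 → ℂ}
    (h : ∀ n : ℕ, pochs q (lowerW q a p) n ≠ 0) (k : ℕ) : a * q ^ (2 * k) ≠ 1 := by
  simp only [pochs_lowerW] at h
  have h1 := mul_pow_ne_one_of_poch_ne_zero (fun n => left_ne_zero_of_mul (h n)) k
  have h2 := mul_pow_ne_one_of_poch_ne_zero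
    (fun n => left_ne_zero_of_mul (right_ne_zero_of_mul (h n))) k
  intro h3
  have h4 : (1 - a.sqrt * q ^ k) * (1 - -a.sqrt * q ^ k) = 0 := by
    linear_combination -(q ^ k) ^ 2 * sqrt_mul_self a - h3
  rcases mul_eq_zero.1 h4 with h4 | h4
  · exact h1 (sub_eq_zero.1 h4).symm
  · exact h2 (sub_eq_zero.1 h4).symm

lemma pochInf_ne_zero_of_lowerW {q : ℂ} (hq1 : ‖q‖ < 1) {a : ℂ} {p : Fin 7 → ℂ}
    (h : ∀ n : ℕ, pochs q (lowerW q a p) n ≠ 0) (j : Fin 7) : pochInf q (a * q / p j) ≠ 0 := by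
  simp only [pochs_lowerW] at h
  refine pochInf_ne_zero hq1 (mul_pow_ne_one_of_poch_ne_zero fun n => ?_)
  exact Finset.prod_ne_zero_iff.1 (right_ne_zero_of_mul (right_ne_zero_of_mul (h n))) j
    (Finset.mem_univ j)

/-- The complementary pair is continuous at regular points, along generic parameters. -/
theorem tendsto_Phi {α : Type*} {l : Filter α} {q : ℂ} (hq0 : q ≠ 0) (hq1 : ‖q‖ < 1) {i : Fin 7}
    {A : α → ℂ} {P : α → Fin 7 → ℂ} {a : ℂ} {p : Fin 7 → ℂ} (hA : Tendsto A l (𝓝 a))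
    (hP : ∀ j, Tendsto (fun t => P t j) l (𝓝 (p j))) (ha : a ≠ 0) (hp : ∀ j, p j ≠ 0)
    (hreg : Regular q i a p) (hev : ∀ᶠ t in l, Generic q i (A t) (P t)) :
    Tendsto (fun t => Phi q i (A t) (P t)) l (𝓝 (Phi q i a p)) := by
  obtain ⟨r1, r2, r3⟩ := hreg
  have hc := continuous_pochInf hq1
  have hc' : ∀ {f : α → ℂ} {y : ℂ}, Tendsto f l (𝓝 y) →
      Tendsto (fun t => pochInf q (f t)) l (𝓝 (pochInf q y)) := fun h => (hc.tendsto _).comp h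
  have hsq : Tendsto (fun t => P t i ^ 2 / A t) l (𝓝 (p i ^ 2 / a)) := ((hP i).pow 2).div hA ha
  have hcompl : ∀ j, Tendsto (fun t => compl (A t) (P t) i j) l (𝓝 (compl a p i j)) := fun j => by
    unfold compl
    split_ifs
    · exact hP i
    · exact ((hP i).mul (hP j)).div hA ha
  have hcne : ∀ j, compl a p i j ≠ 0 := fun j => by
    unfold compl
    split_ifs
    · exact hp i
    · exact div_ne_zero (mul_ne_zero (hp i) (hp j)) ha
  have ev : ∀ {x : ℂ}, (∀ k : ℤ, x ≠ q ^ k) → ∀ k : ℕ, x * q ^ (2 * k) ≠ 1 := fun hx k => by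
    exact_mod_cast mul_zpow_ne_one hq0 hx ((2 * k : ℕ) : ℤ)
  have w1 := tendsto_W hq0 hq1 hA hP hp (mul_pow_ne_one_of_lowerW r1)
    (pochInf_ne_zero_of_lowerW hq1 r1) (hev.mono fun t ht => ev ht.a_ne)
  have w2 := tendsto_W hq0 hq1 hsq hcompl hcne (mul_pow_ne_one_of_lowerW r2)
    (pochInf_ne_zero_of_lowerW hq1 r2) (hev.mono fun t ht => ev (by
      have := ht.pp_ne i; rwa [← sq] at this))
  refine w1.add (Tendsto.mul (Tendsto.div ?_ ?_ r3) w2)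
  · simp only [coeffNum, pochsInf, List.map_cons, List.map_nil, List.prod_cons, List.prod_nil,
      mul_one]
    exact ((hc' (hA.mul_const q)).mul (hc' ((hP i).div hA ha))).mul
      (tendsto_finsetProd _ fun j _ => (hc' (hP j)).mul
        (hc' (((hP i).mul_const q).div (hP j) (hp j))))
  · simp only [coeffDen, pochsInf, List.map_cons, List.map_nil, List.prod_cons, List.prod_nil,
      mul_one]
    exact ((hc' ((((hP i).pow 2).mul_const q).div hA ha)).mul
      (hc' (hA.div (hP i) (hp i)))).mul
      (tendsto_finsetProd _ fun j _ => (hc' ((hA.mul_const q).div (hP j) (hp j))).mul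
        (hc' (((hP i).mul (hP j)).div hA ha)))

/-! ### From generic to regular parameters -/

/-- For each `k` there is at most one real `t`, because the norm of $e^{mt}$ determines `t`. -/
lemma countable_exp_eq_zpow (q : ℂ) {x : ℂ} (hx : x ≠ 0) {m : ℤ} (hm : m ≠ 0) :
    {t : ℝ | ∃ k : ℤ, x * Complex.exp (m * t) = q ^ k}.Countable := by
  rw [Set.ofPred_exists]
  refine Set.countable_iUnion fun k => Set.Subsingleton.countable fun s hs t ht => ?_
  have h := mul_left_cancel₀ hx (Eq.trans hs (Eq.symm ht))
  have h2 := congrArg norm h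
  simp only [Complex.norm_exp] at h2
  have h3 := Real.exp_injective h2
  have h4 : ∀ r : ℝ, ((m : ℂ) * (r : ℂ)).re = m * r := fun r => by
    rw [← Complex.ofReal_intCast, ← Complex.ofReal_mul, Complex.ofReal_re]
  rw [h4, h4] at h3
  exact mul_left_cancel₀ (Int.cast_ne_zero.2 hm) h3

/-- The weights of a one-parameter deformation that moves every point to generic ones. -/
def weight : Fin 7 → ℤ := ![2, -2, -3, -4, -5, 7, 8]

/-- The deformation of the parameters `p`. -/
noncomputable def deform (p : Fin 7 → ℂ) (t : ℝ) : Fin 7 → ℂ :=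
  fun j => p j * Complex.exp (weight j * t)

lemma countable_not_generic {q : ℂ} (i : Fin 7) {a : ℂ} {p : Fin 7 → ℂ} (ha : a ≠ 0)
    (hp : ∀ j, p j ≠ 0) :
    {t : ℝ | ¬ Generic q i (a * Complex.exp (t : ℂ)) (deform p t)}.Countable := by
  -- With weight $1$ for `a`, these say that every quantity that `Generic` keeps away from powers of
  -- $q$ really moves with `t`.
  have w1 : ∀ j, weight j ≠ 0 := by decide
  have w2 : ∀ j, weight j - 1 ≠ 0 := by decide
  have w3 : ∀ i j, weight i + weight j - 1 ≠ 0 := by decide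
  have w4 : ∀ i j, j ≠ i → weight i - weight j ≠ 0 := by decide
  have c0 := countable_exp_eq_zpow q ha one_ne_zero
  have c1 := Set.countable_iUnion fun j => countable_exp_eq_zpow q (hp j) (w1 j)
  have c2 := Set.countable_iUnion fun j => countable_exp_eq_zpow q
    (div_ne_zero (mul_ne_zero (hp i) (hp j)) ha) (w3 i j)
  have c3 := Set.countable_iUnion fun j => countable_exp_eq_zpow q
    (div_ne_zero (hp j) ha) (w2 j)
  have c4 := Set.countable_iUnion fun j : {j : Fin 7 // j ≠ i} => countable_exp_eq_zpow q
    (div_ne_zero (hp i) (hp j)) (w4 i j j.2)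
  refine ((((c0.union c1).union c2).union c3).union c4).mono fun t ht => ?_
  by_contra hn
  simp only [Set.mem_union, Set.mem_iUnion, Set.mem_ofPred_eq, not_or, not_exists] at hn
  obtain ⟨⟨⟨⟨n0, n1⟩, n2⟩, n3⟩, n4⟩ := hn
  refine ht ⟨mul_ne_zero ha (Complex.exp_ne_zero _),
    fun j => mul_ne_zero (hp j) (Complex.exp_ne_zero _), fun k => ?_, fun j k => n1 j k,
    fun j k => ?_, fun j k => ?_, fun j hj k => ?_⟩
  · simpa using n0 k
  · have h := n2 j k
    simp only [deform]
    rwa [show p i * Complex.exp (weight i * t) * (p j * Complex.exp (weight j * t))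
        / (a * Complex.exp t) = p i * p j / a * Complex.exp ((weight i + weight j - 1 : ℤ) * t) by
      push_cast
      rw [sub_mul, add_mul, one_mul, Complex.exp_sub, Complex.exp_add]
      ring]
  · have h := n3 j k
    simp only [deform]
    rwa [show p j * Complex.exp (weight j * t) / (a * Complex.exp t)
        = p j / a * Complex.exp ((weight j - 1 : ℤ) * t) by
      push_cast
      rw [sub_mul, one_mul, Complex.exp_sub]
      ring]
  · have h := n4 ⟨j, hj⟩ k
    simp only [deform]
    rwa [show p i * Complex.exp (weight i * t) / (p j * Complex.exp (weight j * t))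
        = p i / p j * Complex.exp ((weight i - weight j : ℤ) * t) by
      push_cast
      rw [sub_mul, Complex.exp_sub]
      ring]

lemma tendsto_shiftCoeff {α : Type*} {l : Filter α} {q a b c d e f g h : ℂ}
    {A B C D E F G H : α → ℂ} (tA : Tendsto A l (𝓝 a)) (tB : Tendsto B l (𝓝 b))
    (tC : Tendsto C l (𝓝 c)) (tD : Tendsto D l (𝓝 d)) (tE : Tendsto E l (𝓝 e))
    (tF : Tendsto F l (𝓝 f)) (tG : Tendsto G l (𝓝 g)) (tH : Tendsto H l (𝓝 h))
    (hb : b ≠ 0) (hc : c ≠ 0) (hd : d ≠ 0) (he : e ≠ 0) (hf : f ≠ 0) (hg : g ≠ 0) (hh : h ≠ 0)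
    (h1 : g ≠ h * q) :
    Tendsto (fun t => shiftCoeff q (A t) (B t) (C t) (D t) (E t) (F t) (G t) (H t)) l
      (𝓝 (shiftCoeff q a b c d e f g h)) := by
  unfold shiftCoeff
  have tq := tA.mul_const q
  have k : ∀ {X : α → ℂ} {x : ℂ}, Tendsto X l (𝓝 x) → x ≠ 0 →
      Tendsto (fun t => 1 - A t * q / (G t * X t)) l (𝓝 (1 - a * q / (g * x))) := fun hX hx =>
    (tq.div (tG.mul hX) (mul_ne_zero hg hx)).const_sub 1
  refine Tendsto.div (((((((((tG.mul (tH.const_sub 1)).mul ((tA.div tH hh).const_sub 1)).mul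
    ((tq.div tH hh).const_sub 1)).mul (k tB hb)).mul (k tC hc)).mul (k tD hd)).mul (k tE he)).mul
    (k tF hf))) (((tH.mul_const q).div tG hg).const_sub 1) ?_
  rw [sub_ne_zero, ne_comm]
  intro h2
  exact h1 ((div_eq_one_iff_eq hg).1 h2).symm

lemma tendsto_baseCoeff {α : Type*} {l : Filter α} {q a b c d e f g h : ℂ} (hq0 : q ≠ 0)
    {A B C D E F G H : α → ℂ} (tA : Tendsto A l (𝓝 a)) (tB : Tendsto B l (𝓝 b))
    (tC : Tendsto C l (𝓝 c)) (tD : Tendsto D l (𝓝 d)) (tE : Tendsto E l (𝓝 e))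
    (tF : Tendsto F l (𝓝 f)) (tG : Tendsto G l (𝓝 g)) (tH : Tendsto H l (𝓝 h))
    (ha : a ≠ 0) (hg : g ≠ 0) (hh : h ≠ 0) :
    Tendsto (fun t => baseCoeff q (A t) (B t) (C t) (D t) (E t) (F t) (G t) (H t)) l
      (𝓝 (baseCoeff q a b c d e f g h)) := by
  unfold baseCoeff
  have tq := tA.mul_const q
  exact ((((((((tq.div tH hh).mul ((tH.div tG hg).const_sub 1)).mul
    (((tG.mul tH).div tq (mul_ne_zero ha hq0)).const_sub 1)).mul (tB.const_sub 1)).mul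
    (tC.const_sub 1)).mul (tD.const_sub 1)).mul (tE.const_sub 1)).mul (tF.const_sub 1))

/-- Every term of the relation converges, and the conditions $g\ne hq$, $h\ne gq$ persist near the
limit, so the generic relation passes to it. -/
lemma Phi_contiguous_of_tendsto {α : Type*} {l : Filter α} [l.NeBot] {q : ℂ} (hq0 : q ≠ 0)
    (hq1 : ‖q‖ < 1) {i : Fin 7} {a b c d e f g h : ℂ}
    {A B C D E F G H : α → ℂ} (tA : Tendsto A l (𝓝 a)) (tB : Tendsto B l (𝓝 b))
    (tC : Tendsto C l (𝓝 c)) (tD : Tendsto D l (𝓝 d)) (tE : Tendsto E l (𝓝 e))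
    (tF : Tendsto F l (𝓝 f)) (tG : Tendsto G l (𝓝 g)) (tH : Tendsto H l (𝓝 h))
    (hgen : ∀ᶠ t in l, Generic q i (A t) ![B t, C t, D t, E t, F t, G t, H t])
    (hbal : ∀ t, B t * C t * D t * E t * F t * G t * H t = A t ^ 3 * q ^ 2)
    (ha : a ≠ 0) (hb : b ≠ 0) (hc : c ≠ 0) (hd : d ≠ 0) (he : e ≠ 0) (hf : f ≠ 0)
    (hg : g ≠ 0) (hh : h ≠ 0)
    (r0 : Regular q i a ![b, c, d, e, f, g, h])
    (rm : Regular q i a ![b, c, d, e, f, g / q, h * q])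
    (rp : Regular q i a ![b, c, d, e, f, g * q, h / q]) (h1 : g ≠ h * q) (h2 : h ≠ g * q) :
    shiftCoeff q a b c d e f g h
        * (Phi q i a ![b, c, d, e, f, g / q, h * q] - Phi q i a ![b, c, d, e, f, g, h])
      - shiftCoeff q a b c d e f h g
        * (Phi q i a ![b, c, d, e, f, g * q, h / q] - Phi q i a ![b, c, d, e, f, g, h])
      - baseCoeff q a b c d e f g h * Phi q i a ![b, c, d, e, f, g, h] = 0 := by
  have gm : ∀ᶠ t in l, Generic q i (A t) ![B t, C t, D t, E t, F t, G t / q, H t * q] :=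
    hgen.mono fun t ht => ht.of_zpow hq0 ![0, 0, 0, 0, 0, -1, 1] fun j => by
      fin_cases j <;> simp [div_eq_mul_inv]
  have gp : ∀ᶠ t in l, Generic q i (A t) ![B t, C t, D t, E t, F t, G t * q, H t / q] :=
    hgen.mono fun t ht => ht.of_zpow hq0 ![0, 0, 0, 0, 0, 1, -1] fun j => by
      fin_cases j <;> simp [div_eq_mul_inv]
  have t0 := tendsto_Phi hq0 hq1 (P := fun t => ![B t, C t, D t, E t, F t, G t, H t]) tA
    (fun j => by fin_cases j <;> assumption) ha (fun j => by fin_cases j <;> assumption) r0 hgen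
  have tm := tendsto_Phi hq0 hq1 (P := fun t => ![B t, C t, D t, E t, F t, G t / q, H t * q]) tA
    (fun j => by
      fin_cases j <;> first | assumption | exact tG.div_const q | exact tH.mul_const q) ha
    (fun j => by
      fin_cases j <;> first | assumption | exact div_ne_zero hg hq0 | exact mul_ne_zero hh hq0)
    rm gm
  have tp := tendsto_Phi hq0 hq1 (P := fun t => ![B t, C t, D t, E t, F t, G t * q, H t / q]) tA
    (fun j => by
      fin_cases j <;> first | assumption | exact tG.mul_const q | exact tH.div_const q) ha
    (fun j => by
      fin_cases j <;> first | assumption | exact mul_ne_zero hg hq0 | exact div_ne_zero hh hq0)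
    rp gp
  have k1 := tendsto_shiftCoeff tA tB tC tD tE tF tG tH hb hc hd he hf hg hh h1
  have k2 := tendsto_shiftCoeff tA tB tC tD tE tF tH tG hb hc hd he hf hh hg h2
  have k3 := tendsto_baseCoeff hq0 tA tB tC tD tE tF tG tH ha hg hh
  have hlim := ((k1.mul (tm.sub t0)).sub (k2.mul (tp.sub t0))).sub (k3.mul t0)
  refine tendsto_nhds_unique hlim (Tendsto.congr' ?_ tendsto_const_nhds)
  have n1 : ∀ᶠ t in l, G t - H t * q ≠ 0 :=
    (tG.sub (tH.mul_const q)).eventually_ne (sub_ne_zero.2 h1)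
  have n2 : ∀ᶠ t in l, H t - G t * q ≠ 0 :=
    (tH.sub (tG.mul_const q)).eventually_ne (sub_ne_zero.2 h2)
  filter_upwards [hgen, n1, n2] with t ht ht1 ht2
  exact (Phi_contiguous_of_generic hq0 hq1 ht (hbal t) (sub_ne_zero.1 ht1)
    (sub_ne_zero.1 ht2)).symm

/-- The contiguous relation at regular points. -/
theorem Phi_contiguous {q : ℂ} (hq0 : q ≠ 0) (hq1 : ‖q‖ < 1) {i : Fin 7}
    {a b c d e f g h : ℂ} (ha : a ≠ 0) (bal : b * c * d * e * f * g * h = a ^ 3 * q ^ 2)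
    (r0 : Regular q i a ![b, c, d, e, f, g, h])
    (rm : Regular q i a ![b, c, d, e, f, g / q, h * q])
    (rp : Regular q i a ![b, c, d, e, f, g * q, h / q]) (h1 : g ≠ h * q) (h2 : h ≠ g * q) :
    shiftCoeff q a b c d e f g h
        * (Phi q i a ![b, c, d, e, f, g / q, h * q] - Phi q i a ![b, c, d, e, f, g, h])
      - shiftCoeff q a b c d e f h g
        * (Phi q i a ![b, c, d, e, f, g * q, h / q] - Phi q i a ![b, c, d, e, f, g, h])
      - baseCoeff q a b c d e f g h * Phi q i a ![b, c, d, e, f, g, h] = 0 := by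
  have hne : b * c * d * e * f * g * h ≠ 0 := by
    rw [bal]; exact mul_ne_zero (pow_ne_zero _ ha) (pow_ne_zero _ hq0)
  simp only [ne_eq, mul_eq_zero, not_or] at hne
  obtain ⟨⟨⟨⟨⟨⟨hb, hc⟩, hd⟩, he⟩, hf⟩, hg⟩, hh⟩ := hne
  have hp : ∀ j, (![b, c, d, e, f, g, h] : Fin 7 → ℂ) j ≠ 0 := fun j => by
    fin_cases j <;> simpa
  set S := {t : ℝ | ¬ Generic q i (a * Complex.exp (t : ℂ)) (deform ![b, c, d, e, f, g, h] t)}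
    with hS
  -- The exceptional `t` are countable, so $0$ is a limit of good ones.
  have hdense : Dense Sᶜ := (countable_not_generic i ha hp).dense_compl ℝ
  have : (𝓝[Sᶜ] (0 : ℝ)).NeBot := mem_closure_iff_nhdsWithin_neBot.1 (hdense 0)
  set l := 𝓝[Sᶜ] (0 : ℝ) with hl
  have hgen : ∀ᶠ t : ℝ in l,
      Generic q i (a * Complex.exp (t : ℂ)) (deform ![b, c, d, e, f, g, h] t) := by
    filter_upwards [self_mem_nhdsWithin] with t ht
    simpa [hS] using ht
  have texp : ∀ x : ℂ, ∀ m : ℤ, Tendsto (fun t : ℝ => x * Complex.exp (m * t)) l (𝓝 x) :=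
    fun x m => by
    have hcont : Continuous fun t : ℝ => x * Complex.exp (m * t) := by fun_prop
    simpa using (hcont.tendsto 0).mono_left nhdsWithin_le_nhds
  have tA : Tendsto (fun t : ℝ => a * Complex.exp (t : ℂ)) l (𝓝 a) := by simpa using texp a 1
  have hdef : ∀ t : ℝ, deform ![b, c, d, e, f, g, h] t
      = ![b * Complex.exp ((2 : ℤ) * t), c * Complex.exp ((-2 : ℤ) * t),
        d * Complex.exp ((-3 : ℤ) * t), e * Complex.exp ((-4 : ℤ) * t),
        f * Complex.exp ((-5 : ℤ) * t), g * Complex.exp ((7 : ℤ) * t),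
        h * Complex.exp ((8 : ℤ) * t)] := fun t => by
    ext j
    fin_cases j <;> rfl
  simp only [hdef] at hgen
  have hbal : ∀ t : ℝ, b * Complex.exp ((2 : ℤ) * t) * (c * Complex.exp ((-2 : ℤ) * t))
      * (d * Complex.exp ((-3 : ℤ) * t)) * (e * Complex.exp ((-4 : ℤ) * t))
      * (f * Complex.exp ((-5 : ℤ) * t)) * (g * Complex.exp ((7 : ℤ) * t))
      * (h * Complex.exp ((8 : ℤ) * t)) = (a * Complex.exp (t : ℂ)) ^ 3 * q ^ 2 := fun t => by
    -- The weights of the seven parameters add up to $3$, the weight of $a^3$; this preserves the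
    -- balancing condition along the curve.
    have hexp : Complex.exp ((2 : ℤ) * t) * Complex.exp ((-2 : ℤ) * t) * Complex.exp ((-3 : ℤ) * t)
        * Complex.exp ((-4 : ℤ) * t) * Complex.exp ((-5 : ℤ) * t) * Complex.exp ((7 : ℤ) * t)
        * Complex.exp ((8 : ℤ) * t) = Complex.exp (t : ℂ) ^ 3 := by
      rw [← Complex.exp_nat_mul]
      simp only [← Complex.exp_add]
      congr 1
      push_cast
      ring
    rw [mul_pow, ← hexp]
    linear_combination (Complex.exp ((2 : ℤ) * t) * Complex.exp ((-2 : ℤ) * t)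
        * Complex.exp ((-3 : ℤ) * t)
        * Complex.exp ((-4 : ℤ) * t) * Complex.exp ((-5 : ℤ) * t) * Complex.exp ((7 : ℤ) * t)
        * Complex.exp ((8 : ℤ) * t)) * bal
  exact Phi_contiguous_of_tendsto hq0 hq1 tA (texp b 2) (texp c (-2)) (texp d (-3)) (texp e (-4))
    (texp f (-5)) (texp g 7) (texp h 8) hgen hbal ha hb hc hd he hf hg hh r0 rm rp h1 h2

/-! ### The three-term recurrence in $n$ -/

lemma recParams_eq {q : ℂ} (hq0 : q ≠ 0) (a b c d e f h : ℂ) (n : ℤ) {G H : ℂ}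
    (hG : G = recS q a b c d e f * q ^ (n - 1) / h) (hH : H = h * q ^ (-n)) :
    recParams q a b c d e f h n = ![b, c, d, e, f, G, H] ∧
    recParams q a b c d e f h (n + 1) = ![b, c, d, e, f, G * q, H / q] ∧
    recParams q a b c d e f h (n - 1) = ![b, c, d, e, f, G / q, H * q] := by
  unfold recParams
  have e1 : recS q a b c d e f * q ^ (n + 1 - 1) / h = G * q := by
    rw [hG, show n + 1 - 1 = (n - 1) + 1 by ring, zpow_add_one₀ hq0]; ring
  have e2 : h * q ^ (-(n + 1)) = H / q := by
    rw [hH, show -(n + 1) = -n - 1 by ring, zpow_sub_one₀ hq0]; ring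
  have e3 : recS q a b c d e f * q ^ (n - 1 - 1) / h = G / q := by
    rw [hG, zpow_sub_one₀ hq0 (n - 1)]; ring
  have e4 : h * q ^ (-(n - 1)) = H * q := by
    rw [hH, show -(n - 1) = -n + 1 by ring, zpow_add_one₀ hq0]; ring
  rw [e1, e2, e3, e4, hG, hH]
  exact ⟨rfl, rfl, rfl⟩

/-- The normalizing factors satisfy a first-order recurrence with coefficient `recA`. -/
lemma norm_mul_recA {q : ℂ} (hq0 : q ≠ 0) (hq1 : ‖q‖ < 1) (a b c d e f h : ℂ) (n : ℤ)
    (h1 : recS q a b c d e f * q ^ (2 * n) / h ^ 2 ≠ 1)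
    (h2 : recS q a b c d e f * q ^ (2 * n - 1) / h ^ 2 ≠ 1)
    (h3 : a * q ^ (n + 1) / h ≠ 1) (hd : normDen q a b c d e f h n ≠ 0) :
    normNum q a b c d e f h n / normDen q a b c d e f h n * recA q a b c d e f h n
      = normNum q a b c d e f h (n + 1) / normDen q a b c d e f h (n + 1) := by
  unfold normNum normDen recA at *
  simp only [pochsInf, List.map_cons, List.map_nil, List.prod_cons, List.prod_nil, mul_one] at *
  set s := recS q a b c d e f
  have step : ∀ {x y : ℂ}, y = x * q → pochInf q x = (1 - x) * pochInf q y :=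
    fun h => pochInf_of_eq_mul hq1 h
  have m1 : ∀ y : ℂ, s * q ^ (n + 1 - 1) / y = s * q ^ (n - 1) / y * q := fun y => by
    rw [show n + 1 - 1 = (n - 1) + 1 by ring, zpow_add_one₀ hq0]; ring
  have m2 : ∀ y : ℂ, a * q ^ (n + 1 + 1) / y = a * q ^ (n + 1) / y * q := fun y => by
    rw [zpow_add_one₀ hq0 (n + 1)]; ring
  have m3 : s * q ^ (2 * n) / h ^ 2 = s * q ^ (2 * n - 1) / h ^ 2 * q := by
    rw [show 2 * n = (2 * n - 1) + 1 by ring, zpow_add_one₀ hq0]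
    rw [show 2 * n - 1 + 1 - 1 = 2 * n - 1 by ring]
    ring
  have m4 : s * q ^ (2 * (n + 1) - 1) / h ^ 2 = s * q ^ (2 * n) / h ^ 2 * q := by
    rw [show 2 * (n + 1) - 1 = 2 * n + 1 by ring, zpow_add_one₀ hq0]; ring
  rw [step (m1 h), step (m1 (a * h)), step (m2 (b * h)), step (m2 (c * h)), step (m2 (d * h)),
    step (m2 (e * h)), step (m2 (f * h))] at hd ⊢
  rw [step (m2 h), step m3, step m4]
  replace h1 := sub_ne_zero.2 h1.symm
  replace h2 := sub_ne_zero.2 h2.symm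
  replace h3 := sub_ne_zero.2 h3.symm
  simp only [ne_eq, mul_eq_zero, not_or] at hd
  obtain ⟨⟨d1, k1⟩, ⟨d2, k2⟩, ⟨d3, k3⟩, ⟨d4, k4⟩, ⟨d5, k5⟩, ⟨d6, k6⟩, d7, k7⟩ := hd
  generalize 1 - s * q ^ (2 * n) / h ^ 2 = A1 at *
  generalize 1 - s * q ^ (2 * n - 1) / h ^ 2 = A2 at *
  generalize 1 - a * q ^ (n + 1) / h = A3 at *
  generalize 1 - s * q ^ (n - 1) / h = B1 at *
  generalize 1 - s * q ^ (n - 1) / (a * h) = B2 at *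
  generalize 1 - a * q ^ (n + 1) / (b * h) = B3 at *
  generalize 1 - a * q ^ (n + 1) / (c * h) = B4 at *
  generalize 1 - a * q ^ (n + 1) / (d * h) = B5 at *
  generalize 1 - a * q ^ (n + 1) / (e * h) = B6 at *
  generalize 1 - a * q ^ (n + 1) / (f * h) = B7 at *
  generalize pochInf q (s * q ^ (2 * (n + 1) - 1) / h ^ 2) = C1 at *
  generalize pochInf q (a * q ^ (n + 1 + 1) / h) = C2 at *
  generalize pochInf q (s * q ^ (n + 1 - 1) / h) = D1 at *
  generalize pochInf q (s * q ^ (n + 1 - 1) / (a * h)) = D2 at *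
  generalize pochInf q (a * q ^ (n + 1 + 1) / (b * h)) = D3 at *
  generalize pochInf q (a * q ^ (n + 1 + 1) / (c * h)) = D4 at *
  generalize pochInf q (a * q ^ (n + 1 + 1) / (d * h)) = D5 at *
  generalize pochInf q (a * q ^ (n + 1 + 1) / (e * h)) = D6 at *
  generalize pochInf q (a * q ^ (n + 1 + 1) / (f * h)) = D7 at *
  field_simp

/-- The coefficients of the recurrence are those of the contiguous relation, up to a factor. -/
lemma recCoeffs_eq {q a b c d e f h : ℂ} (n : ℤ) {G H : ℂ} (hq0 : q ≠ 0) (ha : a ≠ 0)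
    (hb : b ≠ 0) (hc : c ≠ 0) (hd : d ≠ 0) (he : e ≠ 0) (hf : f ≠ 0) (hh : h ≠ 0)
    (hG : G = recS q a b c d e f * q ^ (n - 1) / h) (hH : H = h * q ^ (-n))
    (bal : b * c * d * e * f * G * H = a ^ 3 * q ^ 2)
    (k1 : H - G ≠ 0) (k2 : H - G * q ≠ 0) (k4 : H - a * q ≠ 0)
    (k5 : G - a * q ≠ 0) :
    ∃ r : ℂ, recA q a b c d e f h n = -(r * shiftCoeff q a b c d e f H G) ∧
      recB q a b c d e f h n = r * shiftCoeff q a b c d e f G H ∧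
      recCoeffA q a b c d e f h n - recA q a b c d e f h n - recB q a b c d e f h n
        = r * baseCoeff q a b c d e f G H := by
  have hne : b * c * d * e * f * G * H ≠ 0 := by
    rw [bal]; exact mul_ne_zero (pow_ne_zero _ ha) (pow_ne_zero _ hq0)
  simp only [ne_eq, mul_eq_zero, not_or] at hne
  obtain ⟨⟨-, hG0⟩, hH0⟩ := hne
  set s := recS q a b c d e f with hs
  have es : s = G * H * q := by
    rw [hG, hH, zpow_sub_one₀ hq0, zpow_neg]
    have := zpow_ne_zero n hq0
    field_simp
  have eh : h = H * q ^ n := by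
    rw [hH, zpow_neg]
    have := zpow_ne_zero n hq0
    field_simp
  have hQ := zpow_ne_zero n hq0
  have z1 : q ^ (n - 1) = q ^ n / q := zpow_sub_one₀ hq0 n
  have z2 : q ^ (n + 1) = q ^ n * q := zpow_add_one₀ hq0 n
  have z3 : q ^ (2 * n) = q ^ n * q ^ n := by rw [two_mul, zpow_add₀ hq0]
  have z4 : q ^ (2 * n - 1) = q ^ n * q ^ n / q := by rw [zpow_sub_one₀ hq0, z3]; rfl
  have z5 : q ^ (2 * n - 2) = q ^ n * q ^ n / q ^ 2 := by
    rw [zpow_sub₀ hq0, z3]; norm_cast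
  have z6 : q ^ (n - 2) = q ^ n / q ^ 2 := by rw [zpow_sub₀ hq0]; norm_cast
  have hA : recA q a b c d e f h n = (1 - G) * (1 - G / a) * (1 - a * q / (b * H))
      * (1 - a * q / (c * H)) * (1 - a * q / (d * H)) * (1 - a * q / (e * H))
      * (1 - a * q / (f * H)) / ((1 - G * q / H) * (1 - G / H) * (1 - a * q / H)) := by
    simp only [recA, ← hs]
    rw [es, z1, z2, z3, z4, eh]
    generalize q ^ n = Q at *
    congr 1
    · congr 1; congr 1; congr 1; congr 1; congr 1; congr 1
      all_goals field_simp
    · congr 1; congr 1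
      all_goals field_simp
  have hB : recB q a b c d e f h n = q * (1 - 1 / H) * (1 - a / H) * (1 - b * G / (a * q))
      * (1 - c * G / (a * q)) * (1 - d * G / (a * q)) * (1 - e * G / (a * q))
      * (1 - f * G / (a * q)) / ((1 - G / H) * (1 - G / (q * H)) * (1 - G / (a * q))) := by
    simp only [recB, ← hs]
    rw [es, z4, z5, z6, eh]
    generalize q ^ n = Q at *
    congr 1
    · congr 1; congr 1; congr 1; congr 1; congr 1; congr 1; congr 1
      all_goals field_simp
    · congr 1; congr 1
      all_goals field_simp
  have hE : recCoeffA q a b c d e f h n - recA q a b c d e f h n - recB q a b c d e f h n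
      = G / (a * H) * ((1 - G * H / (a * q)) * ((1 - b) * (1 - c) * (1 - d) * (1 - e) * (1 - f))
        / ((1 - a * q / H) * (1 - G / (a * q)))) := by
    simp only [recCoeffA, ← hs]
    rw [add_sub_right_comm, add_sub_right_comm, add_sub_cancel_left, sub_self, zero_add,
      es, z2, z4, z6, eh]
    generalize q ^ n = Q at *
    simp only [← mul_assoc]
    congr 1
    · field_simp
    · congr 1
      · congr 1; congr 1; congr 1; congr 1; congr 1
        field_simp
      · congr 1
        all_goals field_simp
  -- The factor `r` is the right side of `hE` divided by `baseCoeff`, where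
  -- $(1-GH/(aq))(1-b)\cdots(1-f)$ cancels.
  refine ⟨G / a / ((1 - G / H) * (1 - a * q / H) * H * (1 - a * q / G)), ?_, ?_, ?_⟩
  · rw [hA, shiftCoeff]
    rw [mul_comm b H, mul_comm c H, mul_comm d H, mul_comm e H, mul_comm f H]
    generalize 1 - a * q / (H * b) = Y1
    generalize 1 - a * q / (H * c) = Y2
    generalize 1 - a * q / (H * d) = Y3
    generalize 1 - a * q / (H * e) = Y4
    generalize 1 - a * q / (H * f) = Y5
    field_simp
    ring
  -- Reversing the five factors produces $-(aq/G)^5/(bcdef)$, which the balancing condition turns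
  -- into $-a^2q^3H/G^4$.
  · have e1 : (1 - a * q / (G * b)) * (1 - a * q / (G * c)) * (1 - a * q / (G * d))
        * (1 - a * q / (G * e)) * (1 - a * q / (G * f))
        = -(a ^ 2 * q ^ 3 * H / G ^ 4) * ((1 - b * G / (a * q))
      * (1 - c * G / (a * q)) * (1 - d * G / (a * q)) * (1 - e * G / (a * q))
      * (1 - f * G / (a * q))) := by
      have k : ∀ x : ℂ, x ≠ 0 → 1 - a * q / (G * x) = -(a * q / (G * x)) * (1 - x * G / (a * q)) :=
        fun x hx => by field_simp; ring
      have hH' : H = a ^ 3 * q ^ 2 / (b * c * d * e * f * G) := by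
        rw [← bal]; field_simp
      rw [k b hb, k c hc, k d hd, k e he, k f hf, hH']
      generalize 1 - b * G / (a * q) = Y1
      generalize 1 - c * G / (a * q) = Y2
      generalize 1 - d * G / (a * q) = Y3
      generalize 1 - e * G / (a * q) = Y4
      generalize 1 - f * G / (a * q) = Y5
      field_simp
    rw [hB, shiftCoeff]
    rw [show ∀ x y1 y2 y3 y4 y5 : ℂ, x * y1 * y2 * y3 * y4 * y5 = x * (y1 * y2 * y3 * y4 * y5) from
      fun _ _ _ _ _ _ => by ring,
      show ∀ x y1 y2 y3 y4 y5 : ℂ, x * y1 * y2 * y3 * y4 * y5 = x * (y1 * y2 * y3 * y4 * y5) from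
      fun _ _ _ _ _ _ => by ring, e1]
    generalize (1 - b * G / (a * q)) * (1 - c * G / (a * q)) * (1 - d * G / (a * q))
      * (1 - e * G / (a * q)) * (1 - f * G / (a * q)) = Y
    rw [show 1 - a * q / G = -(a * q / G) * (1 - G / (a * q)) by field_simp; ring,
      show 1 - H * q / G = -(H * q / G) * (1 - G / (q * H)) by field_simp; ring,
      show 1 - 1 / H = -(1 - H) / H by field_simp; ring]
    have y4 : 1 - a * q / H ≠ 0 := fun h0 => k4 (by field_simp at h0; simpa using h0)
    generalize 1 - G / (a * q) = Y1
    generalize 1 - G / (q * H) = Y2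
    generalize 1 - G / H = Y3
    generalize 1 - a * q / H = Y4 at *
    generalize 1 - a / H = Y5
    generalize 1 - H = Y6
    field_simp
  · rw [hE, baseCoeff]
    rw [show ∀ x y1 y2 y3 y4 y5 : ℂ, x * y1 * y2 * y3 * y4 * y5 = x * (y1 * y2 * y3 * y4 * y5) from
      fun _ _ _ _ _ _ => by ring]
    generalize (1 - b) * (1 - c) * (1 - d) * (1 - e) * (1 - f) = Y
    have k6 : a * q - G ≠ 0 := fun h => k5 (by linear_combination -h)
    field_simp
    ring

/-- With $F$, $F_\pm$ the values of $\Phi$ at $n$, $n\pm1$, the contiguous relation reads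
$A_nF_+-a_nF+B_nF_-=0$. Multiplication by the normalizing factor $K_n$ gives the claim, since
$K_nA_n=K_{n+1}$ and $K_n=K_{n-1}A_{n-1}$. -/
theorem X_recurrence {q : ℂ} (hq0 : q ≠ 0) (hq1 : ‖q‖ < 1) {i : Fin 7}
    {a b c d e f h : ℂ} {n : ℤ} (ha : a ≠ 0)
    (hb : b ≠ 0) (hc : c ≠ 0) (hd : d ≠ 0) (he : e ≠ 0) (hf : f ≠ 0) (hh : h ≠ 0)
    (hreg : ∀ m ∈ Set.Icc (n - 1) (n + 1),
      Regular q i a (recParams q a b c d e f h m) ∧ normDen q a b c d e f h m ≠ 0)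
    (hk : ∀ k ∈ Set.Icc (2 * n - 3) (2 * n), recS q a b c d e f * q ^ k / h ^ 2 ≠ 1) :
    X q i a b c d e f h (n + 1) - recCoeffA q a b c d e f h n * X q i a b c d e f h n
      + recCoeffB q a b c d e f h n * X q i a b c d e f h (n - 1) = 0 := by
  obtain ⟨rm, dm⟩ := hreg (n - 1) (by constructor <;> omega)
  obtain ⟨r0, d0⟩ := hreg n (by constructor <;> omega)
  obtain ⟨rp, dp⟩ := hreg (n + 1) (by constructor <;> omega)
  -- The exponents $2n$, $2n-1$, $2n-2$ exclude $H=Gq$, $H=G$, $G=Hq$. The exponent $2n-3$ is needed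
  -- only for the denominator of $A_{n-1}$.
  have hk0 := hk (2 * n) (by constructor <;> omega)
  have hk1 := hk (2 * n - 1) (by constructor <;> omega)
  have hk2 := hk (2 * n - 2) (by constructor <;> omega)
  have hk3 := hk (2 * n - 3) (by constructor <;> omega)
  set G := recS q a b c d e f * q ^ (n - 1) / h with hG
  set H := h * q ^ (-n) with hH
  obtain ⟨p0, pp, pm⟩ := recParams_eq hq0 a b c d e f h n hG hH
  have hQ := zpow_ne_zero n hq0
  have hH0 : H ≠ 0 := mul_ne_zero hh (zpow_ne_zero _ hq0)
  have bal : b * c * d * e * f * G * H = a ^ 3 * q ^ 2 := by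
    rw [hG, hH, recS, zpow_sub_one₀ hq0, zpow_neg]
    field_simp
  have hG0 : G ≠ 0 := by
    intro h0
    rw [h0, mul_zero, zero_mul] at bal
    exact mul_ne_zero (pow_ne_zero 3 ha) (pow_ne_zero 2 hq0) bal.symm
  have quot : ∀ k : ℤ, recS q a b c d e f * q ^ (2 * n - 1 + k) / h ^ 2 = G / H * q ^ k :=
    fun k => by
    rw [hG, hH, zpow_add₀ hq0, zpow_sub_one₀ hq0, zpow_sub_one₀ hq0, zpow_neg, two_mul,
      zpow_add₀ hq0]
    field_simp
  have k1 : H - G ≠ 0 := fun h0 => hk1 (by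
    have := quot 0
    rw [add_zero, zpow_zero, mul_one] at this
    rw [this, ← sub_eq_zero.1 h0, div_self hH0])
  have k2 : H - G * q ≠ 0 := fun h0 => hk0 (by
    have := quot 1
    rw [sub_add_cancel, zpow_one] at this
    rw [this, div_mul_eq_mul_div, ← sub_eq_zero.1 h0, div_self hH0])
  have k3 : G - H * q ≠ 0 := fun h0 => hk2 (by
    have := quot (-1)
    rw [show 2 * n - 1 + -1 = 2 * n - 2 by ring, zpow_neg_one] at this
    rw [this, sub_eq_zero.1 h0]
    field_simp)
  -- Regularity gives $aq/p_j\ne1$, hence the remaining denominators of $A_n$, $A_{n-1}$ and $B_n$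
  -- do not vanish.
  have aq : ∀ {m : ℤ}, Regular q i a (recParams q a b c d e f h m) → ∀ j,
      a * q / recParams q a b c d e f h m j ≠ 1 := fun hr j => by
    simpa using mul_pow_ne_one_of_pochInf_ne_zero hq1 (pochInf_ne_zero_of_lowerW hq1 hr.1 j) 0
  have aH : a * q ^ (n + 1) / h = a * q / H := by
    rw [hH, zpow_neg, zpow_add_one₀ hq0]
    field_simp
  have aH' : a * q ^ (n - 1 + 1) / h = a * q / (H * q) := by
    rw [hH, zpow_neg, sub_add_cancel]
    field_simp
  have n6 : a * q / H ≠ 1 := by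
    have := aq r0 6
    rwa [p0] at this
  have n5 : a * q / G ≠ 1 := by
    have := aq r0 5
    rwa [p0] at this
  have m6 : a * q / (H * q) ≠ 1 := by
    have := aq rm 6
    rwa [pm] at this
  have k4 : H - a * q ≠ 0 := fun h0 => n6 (by rw [← sub_eq_zero.1 h0, div_self hH0])
  have k5 : G - a * q ≠ 0 := fun h0 => n5 (by rw [← sub_eq_zero.1 h0, div_self hG0])
  have s0 := norm_mul_recA hq0 hq1 a b c d e f h n hk0 hk1 (by rwa [aH]) d0
  have sm := norm_mul_recA hq0 hq1 a b c d e f h (n - 1)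
    (by rwa [show 2 * (n - 1) = 2 * n - 2 by ring])
    (by rwa [show 2 * (n - 1) - 1 = 2 * n - 3 by ring]) (by rwa [aH']) dm
  rw [sub_add_cancel] at sm
  obtain ⟨r, e1, e2, e3⟩ := recCoeffs_eq n hq0 ha hb hc hd he hf hh hG hH bal k1 k2 k4 k5
  rw [p0] at r0
  rw [pm] at rm
  rw [pp] at rp
  have main := Phi_contiguous hq0 hq1 ha bal r0 rm rp (sub_ne_zero.1 k3) (sub_ne_zero.1 k2)
  unfold X recCoeffB
  rw [p0, pp, pm, ← s0]
  generalize recA q a b c d e f h n = A at *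
  generalize recA q a b c d e f h (n - 1) = A' at *
  generalize recB q a b c d e f h n = B at *
  generalize recCoeffA q a b c d e f h n = E at *
  generalize normNum q a b c d e f h n / normDen q a b c d e f h n = K at *
  generalize normNum q a b c d e f h (n - 1) / normDen q a b c d e f h (n - 1) = K' at *
  generalize Phi q i a ![b, c, d, e, f, G, H] = F at *
  generalize Phi q i a ![b, c, d, e, f, G * q, H / q] = Fp at *
  generalize Phi q i a ![b, c, d, e, f, G / q, H * q] = Fm at *
  linear_combination B * Fm * sm + K * r * main + K * (Fp - F) * e1 + K * (Fm - F) * e2 - K * F * e3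

end QHyp

theorem theorem2p4 (q : ℂ) (hq0 : q ≠ 0) (hq1 : ‖q‖ < 1) (i : Fin 7) :
    (∀ a b c d e f g h : ℂ, a ≠ 0 → b * c * d * e * f * g * h = a ^ 3 * q ^ 2 →
      QHyp.Regular q i a ![b, c, d, e, f, g, h] →
      QHyp.Regular q i a ![b, c, d, e, f, g / q, h * q] →
      QHyp.Regular q i a ![b, c, d, e, f, g * q, h / q] →
      g ≠ h * q → h ≠ g * q →
      g * (1 - h) * (1 - a / h) * (1 - a * q / h)
          * (1 - a * q / (g * b)) * (1 - a * q / (g * c)) * (1 - a * q / (g * d))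
          * (1 - a * q / (g * e)) * (1 - a * q / (g * f)) / (1 - h * q / g)
          * (QHyp.Phi q i a ![b, c, d, e, f, g / q, h * q]
              - QHyp.Phi q i a ![b, c, d, e, f, g, h])
        - h * (1 - g) * (1 - a / g) * (1 - a * q / g)
          * (1 - a * q / (h * b)) * (1 - a * q / (h * c)) * (1 - a * q / (h * d))
          * (1 - a * q / (h * e)) * (1 - a * q / (h * f)) / (1 - g * q / h)
          * (QHyp.Phi q i a ![b, c, d, e, f, g * q, h / q]
              - QHyp.Phi q i a ![b, c, d, e, f, g, h])
        - a * q / h * (1 - h / g) * (1 - g * h / (a * q))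
          * (1 - b) * (1 - c) * (1 - d) * (1 - e) * (1 - f)
          * QHyp.Phi q i a ![b, c, d, e, f, g, h] = 0) ∧
    (∀ (a b c d e f h : ℂ) (n : ℤ),
      a ≠ 0 → b ≠ 0 → c ≠ 0 → d ≠ 0 → e ≠ 0 → f ≠ 0 → h ≠ 0 →
      (∀ m ∈ Set.Icc (n - 1) (n + 1),
        QHyp.Regular q i a (QHyp.recParams q a b c d e f h m) ∧
        QHyp.normDen q a b c d e f h m ≠ 0) →
      (∀ k ∈ Set.Icc (2 * n - 3) (2 * n), QHyp.recS q a b c d e f * q ^ k / h ^ 2 ≠ 1) →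
      QHyp.X q i a b c d e f h (n + 1)
        - QHyp.recCoeffA q a b c d e f h n * QHyp.X q i a b c d e f h n
        + QHyp.recCoeffB q a b c d e f h n * QHyp.X q i a b c d e f h (n - 1) = 0) := by
  refine ⟨fun a b c d e f g h ha bal r0 rm rp h1 h2 => ?_,
    fun a b c d e f h n ha hb hc hd he hf hh hreg hk =>
      QHyp.X_recurrence hq0 hq1 ha hb hc hd he hf hh hreg hk⟩
  exact QHyp.Phi_contiguous hq0 hq1 ha bal r0 rm rp h1 h2
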